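/- **Setting.** Let $Q$ be a Dynkin quiver, i.e. an orientation of the Dynkin diagram of a simple Lie algebra of type $A_n$ ($n\ge 1$), $D_n$ ($n\ge 4$), $E_6$, $E_7$ or $E_8$, and let $\varrho$ be an involution of $Q$ (an automorphism of the quiver with $\varrho^2=\mathrm{Id}$; $\varrho=\mathrm{Id}$ is allowed). Let $\Phi^+$ be the set of positive roots, on which $\varrho$ acts by $\alpha_i\mapsto\alpha_{\varrho i}$, and let $\Phi^+_1=\{\beta\in\Phi^+\mid\varrho(\beta)\ne\beta\}$. For a finite field $\mathbf k=\mathbb F_q$ and $\beta\in\Phi^+$ let $M_q(\beta)$ be the indecomposable representation of $Q$ over $\mathbf k$ with dimension vector $\beta$, and for $\mu:\Phi^+\to\mathbb N$ put $M_q(\mu)=\bigoplus_{\beta}M_q(\beta)^{\oplus\mu(\beta)}$. The automorphism polynomial $a_\mu(v)\in\mathbb Z[v,v^{-1}]$ is the unique Laurent polynomial such that $|\mathrm{Aut}(M_q(\mu))|=a_\mu(\pm\sqrt q)$ for all prime powers $q$. Let $\mathcal F$ be the set of all $\lambda:\Phi^+\to\mathbb N$ such that $\lambda(\varrho\beta)=\lambda(\beta)$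 for all $\beta\in\Phi^+$ and $\lambda(\beta)$ is even whenever $\varrho(\beta)=\beta$; for $\lambda\in\mathcal F$ let $\lambda_c(\beta)=\lambda(\beta)$ if $\beta\in\Phi^+_1$ and $\lambda_c(\beta)=0$ otherwise. Let $\Phi^+_1\subseteq S\subseteq\Phi^+$ (for instance $S=\Phi^+$ or $S=\Phi^+_1$). A $\varrho$-admissible ordering of $S$ over $\mathbf k$ is a sequence $\beta_1,\dots,\beta_N$ such that $$\beta_1,\varrho(\beta_1),\beta_2,\varrho(\beta_2),\dots,\beta_N,\varrho(\beta_N)$$ (where $\varrho(\beta_j)$ is omitted if $\varrho(\beta_j)=\beta_j$) lists every element of $S$ exactly once, and $\mathrm{Hom}_{\mathbf kQ}(M_q(\gamma),M_q(\beta))=0$ whenever $\gamma$ comes strictly after $\beta$ in this list. **Lemma.** For every $\beta\in\Phi^+$ and $m\in\mathbb N$ the function with value $m$ at $\beta$ and $0$ elsewhere has the automorphism polynomial $$a_{m\beta}(v)=v^{\frac{m(3m-1)}2}(v-v^{-1})^m[m]!,\qquad [m]!=\prod_{i=1}^m\frac{v^i-v^{-i}}{v-v^{-1}} .$$ Let $\lambda\in\mathcal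 F$. Then the automorphism polynomial $a_{\lambda_c}(v)$ exists and is unique, and there is $b_{\lambda_c}(v)\in\mathbb Z[v,v^{-1}]$ with $$a_{\lambda_c}(v)=b_{\lambda_c}(v)^2 .$$ Moreover, for every finite field $\mathbf k=\mathbb F_q$ and every $S$ as above, $\varrho$-admissible orderings of $S$ exist, and for each of them, with $r_j=\lambda_c(\beta_j)$, $$b_{\lambda_c}(v)=\prod_{1\le k<l\le N}v^{2r_kr_l\left(\dim_{\mathbf k}\mathrm{Hom}(M_q(\beta_k),M_q(\beta_l))+\dim_{\mathbf k}\mathrm{Hom}(M_q(\beta_k),M_q(\varrho\beta_l))\right)}\ \prod_{k=1}^N a_{r_k\beta_k}(v),$$ where $b_{\lambda_c}(v)$ does not depend on $\mathbf k$, $S$ or the ordering. -/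

import Mathlib

open scoped LaurentPolynomial

namespace IQuiver

/-! ### Dynkin quivers, positive roots, involutions -/

section Roots

variable (I : Type) [Quiver.{0} I] [DecidableEq I]

/-- The symmetric matrix `c i j = 2 δ i j - #{arrows i → j} - #{arrows j → i}` attached to a quiver
with vertex set `I`. -/
noncomputable def cartan : Matrix I I ℤ := fun i j =>
  (if i = j then 2 else 0) - (Nat.card (i ⟶ j) : ℤ) - (Nat.card (j ⟶ i) : ℤ)

/-- A Dynkin quiver (of type ADE): an orientation of the Dynkin diagram of a simple Lie algebra of
type `A n` (`n ≥ 1`), `D n` (`n ≥ 4`), `E₆`, `E₇` or `E₈`. -/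
structure IsDynkin : Prop where
  finite_hom : ∀ i j : I, Finite (i ⟶ j)
  type_ADE :
    (∃ n : ℕ, 1 ≤ n ∧ ∃ e : I ≃ Fin n, cartan I = (CartanMatrix.A n).submatrix e e) ∨
    (∃ n : ℕ, 4 ≤ n ∧ ∃ e : I ≃ Fin n, cartan I = (CartanMatrix.D n).submatrix e e) ∨
    (∃ e : I ≃ Fin 6, cartan I = CartanMatrix.E₆.submatrix e e) ∨
    (∃ e : I ≃ Fin 7, cartan I = CartanMatrix.E₇.submatrix e e) ∨
    (∃ e : I ≃ Fin 8, cartan I = CartanMatrix.E₈.submatrix e e)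

variable {I}

/-- The simple reflection `s_i β = β - (α_i, β) α_i` of the root lattice `ℤ^I`. -/
noncomputable def reflection [Fintype I] (i : I) (β : I → ℤ) : I → ℤ :=
  β - (∑ j, cartan I i j * β j) • Pi.single i 1

/-- The roots: the elements of `ℤ^I` obtained from the simple roots `α_i` by simple reflections. -/
inductive IsRoot [Fintype I] : (I → ℤ) → Prop
  | simple (i : I) : IsRoot (Pi.single i 1)
  | reflect (i : I) (β : I → ℤ) (h : IsRoot β) : IsRoot (reflection i β)

variable (I) in
/-- The set of positive roots. -/
abbrev PosRoot [Fintype I] : Type := {β : I → ℤ // IsRoot β ∧ ∀ i, 0 ≤ β i}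

end Roots

/-- An involution of a quiver: an automorphism (of vertices and arrows) whose square is the
identity; the identity itself is allowed. -/
structure Involution (I : Type) [Quiver.{0} I] where
  toPrefunctor : I ⥤q I
  sq : toPrefunctor ⋙q toPrefunctor = 𝟭q I

namespace Involution

variable {I : Type} [Quiver.{0} I] (ρ : Involution I)

theorem obj_obj (i : I) : ρ.toPrefunctor.obj (ρ.toPrefunctor.obj i) = i :=
  Prefunctor.congr_obj ρ.sq i

/-- The underlying permutation of the vertices. -/
def perm : Equiv.Perm I := ⟨ρ.toPrefunctor.obj, ρ.toPrefunctor.obj, ρ.obj_obj, ρ.obj_obj⟩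

theorem perm_perm (i : I) : ρ.perm (ρ.perm i) = i := ρ.obj_obj i

theorem map_injective (i j : I) :
    Function.Injective (fun f : i ⟶ j => ρ.toPrefunctor.map f) := by
  intro f g h
  have hf := Prefunctor.congr_hom ρ.sq f
  have hg := Prefunctor.congr_hom ρ.sq g
  simp only [Prefunctor.comp_map, Prefunctor.id_map] at hf hg h
  rw [← hf, ← hg, h]

theorem map_surjective (i j : I) :
    Function.Surjective (fun f : i ⟶ j => ρ.toPrefunctor.map f) := by
  have inj : ∀ {X Y X' Y' : I} (p : X = X') (q : Y = Y') {f g : X ⟶ Y},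
      Quiver.homOfEq f p q = Quiver.homOfEq g p q → f = g := by
    rintro X Y _ _ rfl rfl f g h
    exact h
  intro g
  refine ⟨Quiver.homOfEq (ρ.toPrefunctor.map g) (ρ.obj_obj i) (ρ.obj_obj j), ?_⟩
  exact ρ.map_injective _ _ (inj (ρ.obj_obj i) (ρ.obj_obj j) (Prefunctor.congr_hom ρ.sq
    (Quiver.homOfEq (ρ.toPrefunctor.map g) (ρ.obj_obj i) (ρ.obj_obj j))))

variable [DecidableEq I]

theorem cartan_perm (i j : I) : cartan I (ρ.perm i) (ρ.perm j) = cartan I i j := by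
  have h : ∀ i j : I, Nat.card (ρ.perm i ⟶ ρ.perm j) = Nat.card (i ⟶ j) := fun i j =>
    (Nat.card_congr (Equiv.ofBijective _ ⟨ρ.map_injective i j, ρ.map_surjective i j⟩)).symm
  simp [cartan, h]

variable [Fintype I]

theorem isRoot_comp {β : I → ℤ} (h : IsRoot β) : IsRoot (β ∘ ρ.perm) := by
  have key : ∀ i : I, (Pi.single i 1 : I → ℤ) ∘ ρ.perm = Pi.single (ρ.perm i) 1 := by
    intro i
    funext j
    by_cases hj : j = ρ.perm i
    · subst hj; simp [perm_perm]
    · have hj' : ρ.perm j ≠ i := fun hh => hj (by rw [← hh, perm_perm])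
      simp [hj, hj']
  induction h with
  | simple i => rw [key]; exact .simple _
  | reflect i β _ ih =>
    have e : reflection i β ∘ ρ.perm = reflection (ρ.perm i) (β ∘ ρ.perm) := by
      have hs : ∑ j, cartan I i j * β j = ∑ j, cartan I (ρ.perm i) j * (β ∘ ρ.perm) j := by
        rw [← Equiv.sum_comp ρ.perm (fun j => cartan I i j * β j)]
        refine Finset.sum_congr rfl fun j _ => ?_
        rw [← ρ.cartan_perm i (ρ.perm j), perm_perm]
        rfl
      unfold reflection
      rw [← hs, ← key]
      rfl
    rw [e]
    exact .reflect _ _ ih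

/-- The action of an involution on positive roots, determined by `α_i ↦ α_{ρ i}`. -/
def act (β : PosRoot I) : PosRoot I :=
  ⟨β.1 ∘ ρ.perm, ρ.isRoot_comp β.2.1, fun i => β.2.2 (ρ.perm i)⟩

/-- The positive roots that are not fixed by the involution. -/
def nonfixed : Set (PosRoot I) := {β | ρ.act β ≠ β}

/-- The functions `lam : Φ⁺ → ℕ` that are invariant under the involution and take even values on
the positive roots fixed by it. -/
def IsF (lam : PosRoot I → ℕ) : Prop :=
  (∀ β, lam (ρ.act β) = lam β) ∧ ∀ β, ρ.act β = β → 2 ∣ lam β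

/-- The part `lam_c` of `lam` supported on the positive roots that are not fixed. -/
def cPart (lam : PosRoot I → ℕ) : PosRoot I → ℕ := fun β => if ρ.act β = β then 0 else lam β

end Involution

/-! ### Representations of a quiver -/

/-- A representation of a quiver `I` over `k`, equivalently a module over the path algebra. -/
structure Rep (k : Type) [Field k] (I : Type) [Quiver.{0} I] where
  V : I → Type
  [addCommGroup : ∀ i, AddCommGroup (V i)]
  [module : ∀ i, Module k (V i)]
  map : ∀ {i j : I}, (i ⟶ j) → V i →ₗ[k] V j

attribute [instance] Rep.addCommGroup Rep.module

namespace Rep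

variable {k : Type} [Field k] {I : Type} [Quiver.{0} I]

/-- The `k`-space of homomorphisms of representations. -/
def Hom (M N : Rep k I) : Submodule k (∀ i, M.V i →ₗ[k] N.V i) where
  carrier := {f | ∀ (i j : I) (a : i ⟶ j), f j ∘ₗ M.map a = N.map a ∘ₗ f i}
  add_mem' hf hg i j a := by
    simp only [Pi.add_apply, LinearMap.add_comp, LinearMap.comp_add, hf i j a, hg i j a]
  zero_mem' i j a := by simp
  smul_mem' c f hf i j a := by
    simp only [Pi.smul_apply, LinearMap.smul_comp, LinearMap.comp_smul, hf i j a]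

/-- The automorphisms of a representation. -/
def Aut (M : Rep k I) : Type :=
  {f : ∀ i, M.V i ≃ₗ[k] M.V i //
    ∀ (i j : I) (a : i ⟶ j) (x : M.V i), f j (M.map a x) = M.map a (f i x)}

/-- A family of subspaces that is a subrepresentation. -/
def IsSubrep (M : Rep k I) (U : ∀ i, Submodule k (M.V i)) : Prop :=
  ∀ (i j : I) (a : i ⟶ j), (U i).map (M.map a) ≤ U j

/-- `M` is nonzero and is not the direct sum of two nonzero subrepresentations. -/
def IsIndecomposable (M : Rep k I) : Prop :=
  (∃ i, Nontrivial (M.V i)) ∧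
  ∀ U W : ∀ i, Submodule k (M.V i), M.IsSubrep U → M.IsSubrep W → (∀ i, IsCompl (U i) (W i)) →
    (∀ i, U i = ⊥) ∨ (∀ i, W i = ⊥)

/-- `M` is finite dimensional with dimension vector `d`. -/
def HasDimVector (M : Rep k I) (d : I → ℤ) : Prop :=
  ∀ i, Module.Finite k (M.V i) ∧ (Module.finrank k (M.V i) : ℤ) = d i

/-- The direct sum of a family of representations (only used for finite families, for which the
direct sum is the product). -/
def directSum {ι : Type} (M : ι → Rep k I) : Rep k I where
  V i := ∀ p : ι, (M p).V i
  map a := LinearMap.pi fun p => (M p).map a ∘ₗ LinearMap.proj p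

end Rep

/-! ### The representations attached to positive roots, and automorphism polynomials -/

section Generic

variable (k : Type) [Field k] (I : Type) [Quiver.{0} I] [DecidableEq I] [Fintype I]

/-- A choice, for every positive root `β`, of an indecomposable representation `M β` over `k` with
dimension vector `β`. -/
structure IndecFamily where
  M : PosRoot I → Rep k I
  indecomposable : ∀ β, (M β).IsIndecomposable
  dimVector : ∀ β, (M β).HasDimVector β.1

variable {k I}

/-- The representation `M(mu) = ⨁_β M(β)^{mu(β)}`. -/
def IndecFamily.sum (F : IndecFamily k I) (mu : PosRoot I → ℕ) : Rep k I :=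
  Rep.directSum fun p : Σ β : PosRoot I, Fin (mu β) => F.M p.1

/-- `dim_k Hom(M(β), M(γ))`. -/
noncomputable def IndecFamily.homDim (F : IndecFamily k I) (β γ : PosRoot I) : ℕ :=
  Module.finrank k (Rep.Hom (F.M β) (F.M γ))

/-- `a` is the automorphism polynomial `a_mu(v)` of `mu`: over every finite field with `q`
elements the representations `M(β)` exist, and the automorphism group of `M(mu)` has
`a(x)` elements for each of the two real square roots `x` of `q`. -/
def IsAutPoly (mu : PosRoot I → ℕ) (a : ℤ[T;T⁻¹]) : Prop :=
  ∀ (k : Type) [Field k] [Finite k], Nonempty (IndecFamily k I) ∧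
    ∀ (F : IndecFamily k I) (x : ℝˣ), (x : ℝ) ^ 2 = Nat.card k →
      (Nat.card (F.sum mu).Aut : ℝ) = LaurentPolynomial.eval₂ (Int.castRingHom ℝ) x a

/-- A sequence enumerating the set `S` of positive roots without repetition is `Q`-admissible if
there are no nonzero homomorphisms from a later to an earlier indecomposable representation. -/
def IndecFamily.IsAdmissible (F : IndecFamily k I) (S : Set (PosRoot I)) (L : List (PosRoot I)) :
    Prop :=
  L.Nodup ∧ (∀ β, β ∈ L ↔ β ∈ S) ∧ L.Pairwise fun β γ => Rep.Hom (F.M γ) (F.M β) = ⊥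

/-- The sequence `β₁, ρβ₁, β₂, ρβ₂, …, β_N, ρβ_N`, where `ρβ_j` is omitted if `ρβ_j = β_j`. -/
def Involution.pairedList (ρ : Involution I) {N : ℕ} (β : Fin N → PosRoot I) : List (PosRoot I) :=
  (List.ofFn β).flatMap fun γ => if ρ.act γ = γ then [γ] else [γ, ρ.act γ]

end Generic

/-! ### The explicit polynomials -/

/-- The quantum integer `[r] = (v^r - v^{-r}) / (v - v^{-1}) = ∑_{i < r} v^{r - 1 - 2 i}`. -/
noncomputable def qInt (r : ℕ) : ℤ[T;T⁻¹] :=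
  ∑ i ∈ Finset.range r, LaurentPolynomial.T ((r : ℤ) - 1 - 2 * i)

/-- The quantum factorial `[m]! = [1] [2] ⋯ [m]`. -/
noncomputable def qFact (m : ℕ) : ℤ[T;T⁻¹] := ∏ i ∈ Finset.range m, qInt (i + 1)

/-- `v^{m(3m-1)/2} (v - v^{-1})^m [m]!`. -/
noncomputable def rootAutPoly (m : ℕ) : ℤ[T;T⁻¹] :=
  LaurentPolynomial.T ((m : ℤ) * (3 * m - 1) / 2) *
    (LaurentPolynomial.T 1 - LaurentPolynomial.T (-1)) ^ m * qFact m

section Formula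

variable {k : Type} [Field k] {I : Type} [Quiver.{0} I] [DecidableEq I] [Fintype I]

/-- With `r_j = mu(β_j)`, the Laurent polynomial
`∏_{i < j} v^{2 r_i r_j (dim Hom(M(β_i), M(β_j)) + dim Hom(M(β_i), M(ρβ_j)))} ⬝
  ∏_j v^{r_j(3r_j-1)/2} (v - v^{-1})^{r_j} [r_j]!`. -/
noncomputable def IndecFamily.sqrtFormula (F : IndecFamily k I) (ρ : Involution I)
    (mu : PosRoot I → ℕ) {N : ℕ} (β : Fin N → PosRoot I) : ℤ[T;T⁻¹] :=
  (∏ j, ∏ i ∈ Finset.Iio j, LaurentPolynomial.T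
    (2 * (mu (β i) : ℤ) * mu (β j) *
      ((F.homDim (β i) (β j) : ℤ) + F.homDim (β i) (ρ.act (β j))))) *
    ∏ j, rootAutPoly (mu (β j))

end Formula

end IQuiver

/-!
The proof has two halves: dimensions of spaces of homomorphisms between indecomposable
representations, and a count of automorphisms in terms of these dimensions.

*Homomorphisms.* The vertices of a Dynkin quiver can be arranged into a periodic sequence such that
each of them is a sink after all arrows at its predecessors have been reversed
(`exists_sinkSequence`). Reflection functors at these sinks preserve indecomposability and spaces of
homomorphisms, as long as the representations are not simple at the sink
(`RelRep.isIndec_iff_of_isReflected`, `RelRep.finrank_hom_eq_of_isReflected`), and act on dimension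
vectors by simple reflections. Since the Coxeter transformation has no nonzero fixed vector and
there are finitely many roots, every positive root becomes the simple root at the current sink after
some number of steps (`SinkSequence.exists_trans_eq_single`), and this number, the weight of the
root, determines the root. Moving two indecomposable representations along until one of them is
simple expresses the dimension of their space of homomorphisms through the dimension vectors alone
(`SinkSequence.finrank_hom`). Therefore the dimension does not depend on the field, it is `1` for
equal roots, and it vanishes if the first root has larger weight (`IsDynkin.exists_weight`). It is
invariant under an involution, because twisting by the involution gives another choice of
indecomposable representations.

*Counting.* With respect to the weight, endomorphisms of `⨁ M(β)^{mu(β)}` are block triangular with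
matrices over the field as diagonal blocks, so that they are invertible if and only if the diagonal
blocks are. This gives `|Aut| = q ^ e * ∏ |GL_{mu(β)}(q)|`, with `e` the sum of
`mu(β) mu(γ) dim Hom(M(γ), M(β))` over `β ≠ γ` (`IndecFamily.card_aut`), and the right hand side is
the value of an explicit Laurent polynomial `autPoly`; the values at the square roots of the primes
determine a Laurent polynomial.

*The square root.* For an invariant `mu` that vanishes at the fixed roots, the nonzero factors
`rootAutPoly (mu β)` occur in equal pairs, and the involution pairs the summands of `e` as well.
Along an admissible ordering this gives `offDiag_eq_two_mul` and hence `sqrtFormula_sq`: the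
product formula of every ordering squares to the automorphism polynomial. As the Laurent
polynomials form a domain and all these products are positive at `v = 2`, they all agree.
Orderings exist, since one can order the orbits of the involution by the sums of the weights over
the orbits (`exists_admissible`).
-/

namespace IQuiver

/-! ### Positive definiteness of the Cartan matrices of type ADE -/

section Form

open Matrix

/-- Positive definiteness of an integral quadratic form, tested on integral vectors. -/
def IsPosForm {I : Type} [Fintype I] (C : Matrix I I ℤ) : Prop :=
  ∀ x : I → ℤ, x ≠ 0 → 0 < x ⬝ᵥ C *ᵥ x

theorem IsPosForm.submatrix {I J : Type} [Fintype I] [Fintype J] {C : Matrix J J ℤ}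
    (hC : IsPosForm C) (e : I ≃ J) : IsPosForm (C.submatrix e e) := by
  intro x hx
  have h := hC (x ∘ e.symm) fun h0 => hx <| by
    funext i
    simpa using congrFun h0 (e i)
  have e1 : x ⬝ᵥ C.submatrix e e *ᵥ x = (x ∘ e.symm) ⬝ᵥ C *ᵥ (x ∘ e.symm) := by
    simp only [dotProduct, mulVec, submatrix_apply]
    rw [← e.sum_comp]
    refine Finset.sum_congr rfl fun i _ => ?_
    rw [← e.sum_comp (fun j => C (e i) j * (x ∘ e.symm) j)]
    simp
  rwa [e1]

/-- Adding a new vertex `0`, joined to the vertex `1` only, to a graph. -/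
theorem form_cons {n : ℕ} (C : Matrix (Fin (n + 2)) (Fin (n + 2)) ℤ) (h00 : C 0 0 = 2)
    (h01 : C 0 1 = -1) (h10 : C 1 0 = -1) (h0 : ∀ j : Fin n, C 0 j.succ.succ = 0)
    (h0' : ∀ j : Fin n, C j.succ.succ 0 = 0) (x : Fin (n + 2) → ℤ) :
    x ⬝ᵥ C *ᵥ x = 2 * x 0 ^ 2 - 2 * x 0 * x 1 +
      (x ∘ Fin.succ) ⬝ᵥ C.submatrix Fin.succ Fin.succ *ᵥ (x ∘ Fin.succ) := by
  have h1 : (Fin.succ 0 : Fin (n + 2)) = 1 := rfl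
  simp only [dotProduct, mulVec, Fin.sum_univ_succ, h1, h00, h01, h10, h0, h0', submatrix_apply,
    Function.comp, zero_mul, Finset.sum_const_zero]
  ring_nf

/-- The value of the form bounds the square of the first coordinate; this stronger form of
positive definiteness survives the addition of a vertex. -/
def BoundsHead {n : ℕ} (C : Matrix (Fin (n + 1)) (Fin (n + 1)) ℤ) : Prop :=
  ∀ x, x 0 ^ 2 ≤ x ⬝ᵥ C *ᵥ x ∧ (x ⬝ᵥ C *ᵥ x = 0 → x = 0)

theorem BoundsHead.isPosForm {n : ℕ} {C : Matrix (Fin (n + 1)) (Fin (n + 1)) ℤ}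
    (hC : BoundsHead C) : IsPosForm C := fun x hx =>
  lt_of_le_of_ne ((sq_nonneg _).trans (hC x).1) fun h => hx ((hC x).2 h.symm)

theorem BoundsHead.cons {n : ℕ} {C : Matrix (Fin (n + 2)) (Fin (n + 2)) ℤ} (h00 : C 0 0 = 2)
    (h01 : C 0 1 = -1) (h10 : C 1 0 = -1) (h0 : ∀ j : Fin n, C 0 j.succ.succ = 0)
    (h0' : ∀ j : Fin n, C j.succ.succ 0 = 0)
    (hC : BoundsHead (C.submatrix Fin.succ Fin.succ)) : BoundsHead C := by
  intro x
  obtain ⟨h1, h2⟩ := hC (x ∘ Fin.succ)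
  have h1' : x 1 ^ 2 ≤ _ := h1
  rw [form_cons C h00 h01 h10 h0 h0' x]
  set Q := (x ∘ Fin.succ) ⬝ᵥ C.submatrix Fin.succ Fin.succ *ᵥ (x ∘ Fin.succ)
  refine ⟨by nlinarith [sq_nonneg (x 0 - x 1)], fun h => ?_⟩
  have hx0 : x 0 = 0 := by
    have : x 0 ^ 2 = 0 := le_antisymm (by nlinarith [sq_nonneg (x 0 - x 1)]) (sq_nonneg _)
    simpa using this
  have hQ : Q = 0 := by simpa [hx0] using h
  funext i
  refine Fin.cases hx0 (fun j => ?_) i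
  simpa using congrFun (h2 hQ) j

theorem boundsHead_A (n : ℕ) : BoundsHead (CartanMatrix.A (n + 1)) := by
  induction n with
  | zero =>
    intro x
    have h : x ⬝ᵥ CartanMatrix.A 1 *ᵥ x = 2 * x 0 ^ 2 := by
      simp [dotProduct, mulVec, CartanMatrix.A]; ring
    refine ⟨by rw [h]; nlinarith [sq_nonneg (x 0)], fun h' => ?_⟩
    have : x 0 = 0 := by simpa [h] using h'
    funext i
    fin_cases i
    exact this
  | succ n ih =>
    refine BoundsHead.cons (by simp [CartanMatrix.A]) (by simp [CartanMatrix.A])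
      (by simp [CartanMatrix.A]) (fun j => ?_) (fun j => ?_) ?_
    · simp [CartanMatrix.A, Fin.ext_iff]
    · simp [CartanMatrix.A, Fin.ext_iff]
    · convert ih using 1
      ext i j
      simp [CartanMatrix.A, Fin.ext_iff]

theorem D_eq_zero {n : ℕ} (i j : Fin n) (hn : 4 ≤ n) (hi : i.val = 0) (hj : 2 ≤ j.val) :
    CartanMatrix.D n i j = 0 ∧ CartanMatrix.D n j i = 0 := by
  have hij : i ≠ j := fun h => by subst h; omega
  constructor
  · rw [CartanMatrix.D, of_apply, if_neg hij]
    iterate 5 rw [if_neg (by omega)]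
  · rw [CartanMatrix.D, of_apply, if_neg hij.symm]
    iterate 5 rw [if_neg (by omega)]

theorem boundsHead_D (n : ℕ) : BoundsHead (CartanMatrix.D (n + 3)) := by
  induction n with
  | zero =>
    intro x
    change Fin 3 → ℤ at x
    change x 0 ^ 2 ≤ x ⬝ᵥ CartanMatrix.D 3 *ᵥ x ∧ (x ⬝ᵥ CartanMatrix.D 3 *ᵥ x = 0 → x = 0)
    have h3 : CartanMatrix.D 3 = !![2, -1, -1; -1, 2, 0; -1, 0, 2] := by decide
    have h : x ⬝ᵥ CartanMatrix.D 3 *ᵥ x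
        = 2 * x 0 ^ 2 + 2 * x 1 ^ 2 + 2 * x 2 ^ 2 - 2 * x 0 * x 1 - 2 * x 0 * x 2 := by
      simp [dotProduct, mulVec, h3, Fin.sum_univ_succ]
      ring
    rw [h]
    have s1 := sq_nonneg (x 0 - 2 * x 1)
    have s2 := sq_nonneg (x 0 - 2 * x 2)
    have s0 := sq_nonneg (x 0)
    refine ⟨by nlinarith, fun h' => ?_⟩
    have h0 : x 0 ^ 2 = 0 := by nlinarith
    have h1 : (x 0 - 2 * x 1) ^ 2 = 0 := by nlinarith
    have h2 : (x 0 - 2 * x 2) ^ 2 = 0 := by nlinarith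
    rw [sq_eq_zero_iff] at h0 h1 h2
    funext i
    fin_cases i
    · exact h0
    · change x 1 = 0; omega
    · change x 2 = 0; omega
  | succ n ih =>
    refine BoundsHead.cons (by simp [CartanMatrix.D]) (by simp [CartanMatrix.D])
      (by simp [CartanMatrix.D]) (fun j => ?_) (fun j => ?_) ?_
    · exact (D_eq_zero _ _ (by omega) rfl (by simp)).1
    · exact (D_eq_zero _ _ (by omega) rfl (by simp)).2
    · convert ih using 1
      ext i j
      have e1 : ¬ (n + 1 + 3 ≤ 2) := by omega
      have e2 : ¬ (n + 3 ≤ 2) := by omega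
      have e4 : ∀ a : ℕ, a + 1 + 2 < n + 1 + 3 ↔ a + 2 < n + 3 := by intros; omega
      simp only [CartanMatrix.D, submatrix_apply, of_apply, Fin.succ_inj, Fin.val_succ, e1, e2, e4,
        Nat.add_right_cancel_iff]

-- In types `E` the form is written as a sum of squares by eliminating the vertices from the ends
-- of the three arms towards the branch vertex `3`.
theorem isPosForm_E₆ : IsPosForm CartanMatrix.E₆ := by
  intro x hx
  by_contra hneg
  have h : 6 * (x ⬝ᵥ CartanMatrix.E₆ *ᵥ x) = 3 * (2 * x 0 - x 2) ^ 2 + 3 * (2 * x 1 - x 3) ^ 2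
      + (3 * x 2 - 2 * x 3) ^ 2 + 3 * (2 * x 5 - x 4) ^ 2 + (3 * x 4 - 2 * x 3) ^ 2
      + x 3 ^ 2 := by
    simp [dotProduct, mulVec, CartanMatrix.E₆, Fin.sum_univ_succ]
    ring
  have s1 := sq_nonneg (2 * x 0 - x 2)
  have s2 := sq_nonneg (2 * x 1 - x 3)
  have s3 := sq_nonneg (3 * x 2 - 2 * x 3)
  have s4 := sq_nonneg (2 * x 5 - x 4)
  have s5 := sq_nonneg (3 * x 4 - 2 * x 3)
  have s6 := sq_nonneg (x 3)
  have t1 := sq_eq_zero_iff.1 (le_antisymm (by linarith) s1)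
  have t2 := sq_eq_zero_iff.1 (le_antisymm (by linarith) s2)
  have t3 := sq_eq_zero_iff.1 (le_antisymm (by linarith) s3)
  have t4 := sq_eq_zero_iff.1 (le_antisymm (by linarith) s4)
  have t5 := sq_eq_zero_iff.1 (le_antisymm (by linarith) s5)
  have t6 := sq_eq_zero_iff.1 (le_antisymm (by linarith) s6)
  apply hx
  funext i
  fin_cases i <;> simp <;> omega

theorem isPosForm_E₇ : IsPosForm CartanMatrix.E₇ := by
  intro x hx
  by_contra hneg
  have h : 12 * (x ⬝ᵥ CartanMatrix.E₇ *ᵥ x) = 6 * (2 * x 0 - x 2) ^ 2 + 6 * (2 * x 1 - x 3) ^ 2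
      + 2 * (3 * x 2 - 2 * x 3) ^ 2 + 6 * (2 * x 6 - x 5) ^ 2 + 2 * (3 * x 5 - 2 * x 4) ^ 2
      + (4 * x 4 - 3 * x 3) ^ 2 + x 3 ^ 2 := by
    simp [dotProduct, mulVec, CartanMatrix.E₇, Fin.sum_univ_succ]
    ring
  have s1 := sq_nonneg (2 * x 0 - x 2)
  have s2 := sq_nonneg (2 * x 1 - x 3)
  have s3 := sq_nonneg (3 * x 2 - 2 * x 3)
  have s4 := sq_nonneg (2 * x 6 - x 5)
  have s5 := sq_nonneg (3 * x 5 - 2 * x 4)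
  have s6 := sq_nonneg (4 * x 4 - 3 * x 3)
  have s7 := sq_nonneg (x 3)
  have t1 := sq_eq_zero_iff.1 (le_antisymm (by linarith) s1)
  have t2 := sq_eq_zero_iff.1 (le_antisymm (by linarith) s2)
  have t3 := sq_eq_zero_iff.1 (le_antisymm (by linarith) s3)
  have t4 := sq_eq_zero_iff.1 (le_antisymm (by linarith) s4)
  have t5 := sq_eq_zero_iff.1 (le_antisymm (by linarith) s5)
  have t6 := sq_eq_zero_iff.1 (le_antisymm (by linarith) s6)
  have t7 := sq_eq_zero_iff.1 (le_antisymm (by linarith) s7)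
  apply hx
  funext i
  fin_cases i <;> simp <;> omega

theorem isPosForm_E₈ : IsPosForm CartanMatrix.E₈ := by
  intro x hx
  by_contra hneg
  have h : 60 * (x ⬝ᵥ CartanMatrix.E₈ *ᵥ x) = 30 * (2 * x 0 - x 2) ^ 2 + 30 * (2 * x 1 - x 3) ^ 2
      + 10 * (3 * x 2 - 2 * x 3) ^ 2 + 30 * (2 * x 7 - x 6) ^ 2 + 10 * (3 * x 6 - 2 * x 5) ^ 2
      + 5 * (4 * x 5 - 3 * x 4) ^ 2 + 3 * (5 * x 4 - 4 * x 3) ^ 2 + 2 * x 3 ^ 2 := by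
    simp [dotProduct, mulVec, CartanMatrix.E₈, Fin.sum_univ_succ]
    ring
  have s1 := sq_nonneg (2 * x 0 - x 2)
  have s2 := sq_nonneg (2 * x 1 - x 3)
  have s3 := sq_nonneg (3 * x 2 - 2 * x 3)
  have s4 := sq_nonneg (2 * x 7 - x 6)
  have s5 := sq_nonneg (3 * x 6 - 2 * x 5)
  have s6 := sq_nonneg (4 * x 5 - 3 * x 4)
  have s7 := sq_nonneg (5 * x 4 - 4 * x 3)
  have s8 := sq_nonneg (x 3)
  have t1 := sq_eq_zero_iff.1 (le_antisymm (by linarith) s1)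
  have t2 := sq_eq_zero_iff.1 (le_antisymm (by linarith) s2)
  have t3 := sq_eq_zero_iff.1 (le_antisymm (by linarith) s3)
  have t4 := sq_eq_zero_iff.1 (le_antisymm (by linarith) s4)
  have t5 := sq_eq_zero_iff.1 (le_antisymm (by linarith) s5)
  have t6 := sq_eq_zero_iff.1 (le_antisymm (by linarith) s6)
  have t7 := sq_eq_zero_iff.1 (le_antisymm (by linarith) s7)
  have t8 := sq_eq_zero_iff.1 (le_antisymm (by linarith) s8)
  apply hx
  funext i
  fin_cases i <;> simp <;> omega

theorem IsDynkin.isPosForm {I : Type} [Quiver.{0} I] [DecidableEq I] [Fintype I]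
    (hQ : IsDynkin I) : IsPosForm (cartan I) := by
  rcases hQ.type_ADE with ⟨n, hn, e, h⟩ | ⟨n, hn, e, h⟩ | ⟨e, h⟩ | ⟨e, h⟩ | ⟨e, h⟩ <;> rw [h]
  · obtain ⟨m, rfl⟩ := Nat.exists_eq_add_of_le' hn
    exact (boundsHead_A m).isPosForm.submatrix e
  · obtain ⟨m, rfl⟩ := Nat.exists_eq_add_of_le' (show 3 ≤ n by omega)
    exact (boundsHead_D m).isPosForm.submatrix e
  · exact isPosForm_E₆.submatrix e
  · exact isPosForm_E₇.submatrix e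
  · exact isPosForm_E₈.submatrix e

end Form

/-! ### Roots of a positive definite quiver -/

section Roots

open Matrix

variable {I : Type} [Quiver.{0} I] [DecidableEq I] [Fintype I]

/-- The symmetric bilinear form on the root lattice. -/
noncomputable def form (x y : I → ℤ) : ℤ := x ⬝ᵥ cartan I *ᵥ y

theorem form_add_left (x y z : I → ℤ) : form (x + y) z = form x z + form y z :=
  add_dotProduct _ _ _

theorem form_sub_left (x y z : I → ℤ) : form (x - y) z = form x z - form y z :=
  sub_dotProduct _ _ _

theorem form_smul_left (c : ℤ) (x y : I → ℤ) : form (c • x) y = c * form x y := by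
  rw [form, smul_dotProduct, smul_eq_mul, form]

omit [Fintype I] in
theorem cartan_symm (i j : I) : cartan I i j = cartan I j i := by
  unfold cartan
  simp only [eq_comm (a := i) (b := j)]
  ring

theorem form_comm (x y : I → ℤ) : form x y = form y x := by
  unfold form
  rw [dotProduct_mulVec, dotProduct_comm, ← mulVec_transpose]
  congr 2
  ext i j
  exact cartan_symm j i

theorem form_add_right (x y z : I → ℤ) : form x (y + z) = form x y + form x z := by
  rw [form_comm, form_add_left, form_comm y, form_comm z]

theorem form_sub_right (x y z : I → ℤ) : form x (y - z) = form x y - form x z := by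
  rw [form_comm, form_sub_left, form_comm y, form_comm z]

theorem form_smul_right (c : ℤ) (x y : I → ℤ) : form x (c • y) = c * form x y := by
  rw [form_comm, form_smul_left, form_comm y]

theorem form_single_left (i : I) (x : I → ℤ) : form (Pi.single i 1) x = (cartan I *ᵥ x) i := by
  simp [form]

theorem form_single_single (i j : I) : form (Pi.single i 1) (Pi.single j 1) = cartan I i j := by
  rw [form_single_left]
  simp

theorem reflection_eq (i : I) (x : I → ℤ) :
    reflection i x = x - form (Pi.single i 1) x • Pi.single i 1 := by
  rw [form_single_left]
  rfl

theorem reflection_apply_of_ne {i j : I} (h : j ≠ i) (x : I → ℤ) : reflection i x j = x j := by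
  simp [reflection, h]

theorem reflection_add (i : I) (x y : I → ℤ) :
    reflection i (x + y) = reflection i x + reflection i y := by
  rw [reflection_eq, reflection_eq, reflection_eq, form_add_right, add_smul]
  abel

theorem form_self_eq (x : I → ℤ) :
    form x x = 2 * ∑ i, x i * (x i - ∑ j, (Nat.card (i ⟶ j) : ℤ) * x j) := by
  let N : Matrix I I ℤ := Matrix.of fun i j => (Nat.card (i ⟶ j) : ℤ)
  have h : cartan I = 2 • (1 : Matrix I I ℤ) - N - Nᵀ := by
    ext i j
    change _ = 2 • (1 : Matrix I I ℤ) i j - Nat.card (i ⟶ j) - Nat.card (j ⟶ i)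
    rw [cartan, one_apply]
    split_ifs <;> simp
  have h' : x ⬝ᵥ Nᵀ *ᵥ x = x ⬝ᵥ N *ᵥ x := by
    rw [mulVec_transpose, dotProduct_comm, dotProduct_mulVec]
  have h2 : ∑ i, x i * (x i - ∑ j, (Nat.card (i ⟶ j) : ℤ) * x j) = x ⬝ᵥ x - x ⬝ᵥ N *ᵥ x := by
    rw [← dotProduct_sub]
    rfl
  rw [h2, form, h, sub_mulVec, sub_mulVec, dotProduct_sub, dotProduct_sub, h', smul_mulVec,
    one_mulVec, dotProduct_smul]
  simp
  ring

/-- The form takes even values on the diagonal. -/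
theorem two_dvd_form_self (x : I → ℤ) : 2 ∣ form x x := ⟨_, form_self_eq x⟩

section Pos

variable (hpos : IsPosForm (cartan I))

include hpos

theorem form_self_pos {x : I → ℤ} (hx : x ≠ 0) : 0 < form x x := hpos x hx

theorem form_self_nonneg (x : I → ℤ) : 0 ≤ form x x := by
  rcases eq_or_ne x 0 with rfl | hx
  · simp [form]
  · exact (hpos x hx).le

theorem two_le_form_self {x : I → ℤ} (hx : x ≠ 0) : 2 ≤ form x x := by
  have := two_dvd_form_self x
  have := form_self_pos hpos hx
  omega

theorem cartan_self (i : I) : cartan I i i = 2 := by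
  have h : 0 < form (Pi.single i (1 : ℤ)) (Pi.single i 1) := form_self_pos hpos (by simp)
  rw [form_single_single] at h
  simp only [cartan, if_true] at h ⊢
  omega

theorem neg_one_le_cartan {i j : I} (hij : i ≠ j) : -1 ≤ cartan I i j := by
  have hne : (Pi.single i 1 + Pi.single j 1 : I → ℤ) ≠ 0 := fun h => by
    have := congrFun h i
    simp [hij] at this
  have h := form_self_pos hpos hne
  rw [form_add_left, form_add_right, form_add_right, form_single_single, form_single_single,
    form_single_single, form_single_single, cartan_self hpos, cartan_self hpos,
    cartan_symm j i] at h
  omega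

omit hpos [Fintype I] in
theorem cartan_nonpos {i j : I} (hij : i ≠ j) : cartan I i j ≤ 0 := by
  simp only [cartan, if_neg hij]
  omega

theorem form_reflection (i : I) (x : I → ℤ) :
    form (reflection i x) (reflection i x) = form x x := by
  rw [reflection_eq, form_sub_left, form_sub_right, form_sub_right, form_smul_left,
    form_smul_right, form_smul_left, form_smul_right, form_single_single, cartan_self hpos,
    form_comm x (Pi.single i 1)]
  ring

theorem reflection_reflection (i : I) (x : I → ℤ) : reflection i (reflection i x) = x := by
  rw [reflection_eq i (reflection i x), reflection_eq i x, form_sub_right, form_smul_right,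
    form_single_single, cartan_self hpos, sub_sub, ← add_smul]
  ring_nf

theorem reflection_injective (i : I) : Function.Injective (reflection (I := I) i) :=
  Function.LeftInverse.injective (reflection_reflection hpos i)

theorem reflection_single (i : I) : reflection i (Pi.single i 1) = -Pi.single i 1 := by
  rw [reflection_eq, form_single_single, cartan_self hpos, two_smul]
  abel

theorem IsRoot.form_self {x : I → ℤ} (hx : IsRoot x) : form x x = 2 := by
  induction hx with
  | simple i => rw [form_single_single, cartan_self hpos]
  | reflect i x _ ih => rw [form_reflection hpos, ih]

theorem finite_form_eq_two : {x : I → ℤ | form x x = 2}.Finite := by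
  have hinj : Function.Injective fun x : I → ℤ => cartan I *ᵥ x := by
    intro x y h
    by_contra hne
    have h1 := form_self_pos hpos (sub_ne_zero.2 hne)
    have h2 : form (x - y) (x - y) = 0 := by
      simp only at h
      rw [form, mulVec_sub, h, sub_self, dotProduct_zero]
    omega
  refine Set.Finite.of_finite_image (f := fun x : I → ℤ => cartan I *ᵥ x)
    ((Set.Finite.pi' fun _ : I => Set.finite_Icc (-2 : ℤ) 2).subset ?_) hinj.injOn
  rintro _ ⟨x, hx, rfl⟩ i
  have h1 := form_self_nonneg hpos (x + Pi.single i 1)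
  have h2 := form_self_nonneg hpos (x - Pi.single i 1)
  rw [form_add_left, form_add_right, form_add_right, form_single_single, form_comm x (Pi.single i 1),
    cartan_self hpos, form_single_left] at h1
  rw [form_sub_left, form_sub_right, form_sub_right, form_single_single, form_comm x (Pi.single i 1),
    cartan_self hpos, form_single_left] at h2
  have hx' : form x x = 2 := hx
  simp only [Set.mem_Icc]
  omega

theorem finite_posRoot : Finite (PosRoot I) :=
  ((finite_form_eq_two hpos).subset fun _ hx => hx.1.form_self hpos :
    {x : I → ℤ | IsRoot x ∧ ∀ i, 0 ≤ x i}.Finite).to_subtype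

/-- A vector of norm two is nonnegative or nonpositive, since its positive and negative parts have
nonpositive pairing and each of them has norm at least two unless it vanishes. -/
theorem nonneg_or_nonpos {x : I → ℤ} (hx : form x x = 2) : (∀ i, 0 ≤ x i) ∨ ∀ i, x i ≤ 0 := by
  set p : I → ℤ := fun i => max (x i) 0 with hp
  set m : I → ℤ := fun i => max (-x i) 0 with hm
  have hxpm : x = p - m := by
    funext i
    simp only [hp, hm, Pi.sub_apply]
    omega
  have hpm : form p m ≤ 0 := by
    simp only [form, dotProduct, mulVec, Finset.mul_sum]
    refine Finset.sum_nonpos fun i _ => Finset.sum_nonpos fun j _ => ?_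
    have hpi : 0 ≤ p i := le_max_right _ _
    have hmj : 0 ≤ m j := le_max_right _ _
    rcases eq_or_ne i j with rfl | hij
    · rcases le_total 0 (x i) with h | h
      · have : m i = 0 := max_eq_right (by omega)
        simp [this]
      · have : p i = 0 := max_eq_right h
        simp [this]
    · exact mul_nonpos_of_nonneg_of_nonpos hpi
        (mul_nonpos_of_nonpos_of_nonneg (cartan_nonpos hij) hmj)
  by_cases hp0 : p = 0
  · right
    intro i
    have := congrFun hp0 i
    simpa [hp] using this
  by_cases hm0 : m = 0
  · left
    intro i
    have := congrFun hm0 i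
    simpa [hm] using this
  have h1 := two_le_form_self hpos hp0
  have h2 := two_le_form_self hpos hm0
  rw [hxpm, form_sub_left, form_sub_right, form_sub_right, form_comm m p] at hx
  omega

/-- A simple reflection permutes the positive roots other than its own simple root. -/
theorem reflection_nonneg {x : I → ℤ} (hx : form x x = 2) (h0 : ∀ j, 0 ≤ x j) {i : I}
    (hi : x ≠ Pi.single i 1) (j : I) : 0 ≤ reflection i x j := by
  rcases nonneg_or_nonpos hpos ((form_reflection hpos i x).trans hx) with h | h
  · exact h j
  · exfalso
    have hxi : x = x i • Pi.single i 1 := by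
      funext j
      rcases eq_or_ne j i with rfl | hj
      · simp
      · have h1 := h j
        rw [reflection_apply_of_ne hj] at h1
        simp [hj, le_antisymm h1 (h0 j)]
    have h2 := hx
    rw [hxi, form_smul_left, form_smul_right, form_single_single, cartan_self hpos] at h2
    have h3 : x i * x i = 1 := by linarith
    have h4 : x i = 1 := by nlinarith [h0 i]
    rw [h4, one_smul] at hxi
    exact hi hxi

end Pos

end Roots

/-! ### Sequences of sinks -/

section SinkSequence

open Matrix

variable {I : Type} [Quiver.{0} I] [DecidableEq I] [Fintype I]

/-- Otherwise the indicator function of a set of vertices without a sink would have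
nonpositive norm. -/
theorem wellFounded_arrow (hfin : ∀ i j : I, Finite (i ⟶ j)) (hpos : IsPosForm (cartan I)) :
    WellFounded fun b a : I => Nonempty (a ⟶ b) := by
  classical
  rw [WellFounded.wellFounded_iff_has_min]
  intro T ⟨c, hc⟩
  by_contra! hT
  set x : I → ℤ := fun i => if i ∈ T then 1 else 0 with hx
  have hx0 : x ≠ 0 := fun h => by simpa [hx, hc] using congrFun h c
  have h1 := form_self_pos hpos hx0
  rw [form_self_eq] at h1
  have h2 : ∑ i, x i * (x i - ∑ j, (Nat.card (i ⟶ j) : ℤ) * x j) ≤ 0 := by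
    refine Finset.sum_nonpos fun i _ => ?_
    by_cases hi : i ∈ T
    · obtain ⟨j, hj, ⟨f⟩⟩ := hT i hi
      have : (1 : ℤ) ≤ ∑ j, (Nat.card (i ⟶ j) : ℤ) * x j := by
        refine le_trans ?_ (Finset.single_le_sum (f := fun j => (Nat.card (i ⟶ j) : ℤ) * x j)
          (fun k _ => ?_) (Finset.mem_univ j))
        · have : 0 < Nat.card (i ⟶ j) := Nat.card_pos_iff.2 ⟨⟨f⟩, hfin i j⟩
          simp only [hx, if_pos hj]
          omega
        · simp only [hx]
          split_ifs <;> simp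
      simp only [hx, if_pos hi] at this ⊢
      linarith
    · simp [hx, hi]
  linarith

theorem exists_sink_numbering (hfin : ∀ i j : I, Finite (i ⟶ j)) (hpos : IsPosForm (cartan I)) :
    ∃ e : Fin (Fintype.card I) ≃ I, ∀ r s, Nonempty (e r ⟶ e s) → s < r := by
  have wf : IsWellFounded I fun b a : I => Nonempty (a ⟶ b) := ⟨wellFounded_arrow hfin hpos⟩
  let f : Fin (Fintype.card I) → Ordinal := fun r =>
    IsWellFounded.rank (fun b a : I => Nonempty (a ⟶ b)) ((Fintype.equivFin I).symm r)
  refine ⟨(Tuple.sort f).trans (Fintype.equivFin I).symm, fun r s h => ?_⟩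
  by_contra! hrs
  exact absurd (Tuple.monotone_sort f hrs) (not_le.2 (IsWellFounded.rank_lt_of_rel h))

variable (I) in
/-- A periodic sequence `v 0, v 1, …` of vertices running through all vertices, together with the
orientations `R 0, R 1, …` of the underlying graph (`R t a b` means that there is an arrow `a → b`)
that arise from the given one by reversing all arrows at `v 0`, then at `v 1`, and so on; each
`v t` has to be a sink of `R t`. -/
structure SinkSequence where
  v : ℕ → I
  R : ℕ → I → I → Prop
  period : ℕ
  zero : ∀ a b, R 0 a b ↔ Nonempty (a ⟶ b)
  sink : ∀ t b, ¬ R t (v t) b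
  source : ∀ t a, ¬ R (t + 1) a (v t)
  flip : ∀ t b, R (t + 1) (v t) b ↔ R t b (v t)
  ne : ∀ t a b, a ≠ v t → b ≠ v t → (R (t + 1) a b ↔ R t a b)
  nbr : ∀ t b, R t b (v t) ↔ b ≠ v t ∧ cartan I (v t) b ≠ 0
  periodic : ∀ t, v (period + t) = v t
  surj : ∀ a, ∃ t < period, v t = a
  inj : ∀ s t, s < period → t < period → v s = v t → s = t

/-- Orient every edge towards its lower end, for heights `h t` such that `h 0` numbers the vertices
in a way that arrows descend; reversing the arrows at the lowest vertex `v t` means raising it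
by the number of vertices. -/
theorem exists_sinkSequence [Nonempty I] (hfin : ∀ i j : I, Finite (i ⟶ j))
    (hpos : IsPosForm (cartan I)) : Nonempty (SinkSequence I) := by
  obtain ⟨n, hn0, e, he⟩ : ∃ n, 0 < n ∧ ∃ e : Fin n ≃ I,
      ∀ r s, Nonempty (e r ⟶ e s) → s < r :=
    ⟨_, Fintype.card_pos, exists_sink_numbering hfin hpos⟩
  set v : ℕ → I := fun t => e ⟨t % n, Nat.mod_lt _ hn0⟩ with hv
  set p : I → ℕ := fun a => (e.symm a).val with hp
  have hpinj : ∀ a b, p a = p b → a = b := fun a b h => e.symm.injective (Fin.ext h)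
  have hpv : ∀ t, p (v t) = t % n := fun t => by simp [hp, hv]
  have hpn : ∀ a, p a < n := fun a => (e.symm a).isLt
  let h : ℕ → I → ℕ := fun t => Nat.rec p (fun t g a => if a = v t then g a + n else g a) t
  have hS : ∀ t a, h (t + 1) a = if a = v t then h t a + n else h t a := fun _ _ => rfl
  have inv : ∀ t a, t ≤ h t a ∧ h t a < t + n ∧ h t a % n = p a := by
    intro t
    induction t with
    | zero => exact fun a => ⟨Nat.zero_le _, by rw [zero_add]; exact hpn a, Nat.mod_eq_of_lt (hpn a)⟩
    | succ t ih =>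
      intro a
      obtain ⟨h1, h2, h3⟩ := ih a
      rw [hS]
      split_ifs with hav
      · rw [Nat.add_mod_right]
        have : h t a = t := by
          have h4 : h t a % n = t % n := by rw [h3, hav, hpv]
          have h5 := Nat.ModEq.dvd (show t ≡ h t a [MOD n] from h4.symm)
          obtain ⟨c, hc⟩ := h5
          have : c < 1 := by
            by_contra! hc1
            nlinarith
          have : 0 ≤ c := by
            by_contra! hc1
            nlinarith
          have : c = 0 := by omega
          subst this
          omega
        exact ⟨by omega, by omega, h3⟩
      · refine ⟨Nat.lt_of_le_of_ne h1 fun h4 => hav (hpinj _ _ ?_), by omega, h3⟩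
        rw [hpv, ← h3, ← h4]
  have hinj : ∀ t a b, h t a = h t b → a = b := fun t a b hab =>
    hpinj _ _ (by rw [← (inv t a).2.2, ← (inv t b).2.2, hab])
  have hvt : ∀ t, h t (v t) = t := by
    intro t
    have h1 := (inv (t + 1) (v t)).2.1
    have h2 := (inv t (v t)).1
    rw [hS, if_pos rfl] at h1
    omega
  have hvlt : ∀ t b, b ≠ v t → t < h t b := fun t b hb =>
    Nat.lt_of_le_of_ne (inv t b).1 fun hh => hb (hinj t _ _ (by rw [hvt, ← hh]))
  have hSv : ∀ t, h (t + 1) (v t) = t + n := fun t => by rw [hS, if_pos rfl, hvt]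
  have hSne : ∀ t b, b ≠ v t → h (t + 1) b = h t b := fun t b hb => by rw [hS, if_neg hb]
  refine ⟨⟨v, fun t a b => cartan I a b ≠ 0 ∧ h t b < h t a, n, ?_, ?_, ?_, ?_, ?_, ?_, ?_, ?_, ?_⟩⟩
  · intro a b
    constructor
    · rintro ⟨h1, h2⟩
      have hab : a ≠ b := by rintro rfl; exact lt_irrefl _ h2
      by_contra hne
      have hba : Nonempty (b ⟶ a) := by
        by_contra hne'
        apply h1
        rw [not_nonempty_iff] at hne hne'
        simp [cartan, hab]
      have h3 := he (e.symm b) (e.symm a) (by simpa using hba)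
      exact absurd h2 (not_lt.2 (le_of_lt h3))
    · intro hab
      have h3 : p b < p a := he (e.symm a) (e.symm b) (by simpa using hab)
      refine ⟨?_, h3⟩
      have hne : a ≠ b := by rintro rfl; exact lt_irrefl _ h3
      have : 0 < Nat.card (a ⟶ b) := Nat.card_pos_iff.2 ⟨hab, hfin a b⟩
      simp only [cartan, if_neg hne]
      omega
  · rintro t b ⟨-, h2⟩
    rw [hvt] at h2
    exact absurd (inv t b).1 (not_le.2 h2)
  · rintro t a ⟨-, h2⟩
    rw [hSv] at h2
    have := (inv (t + 1) a).2.1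
    by_cases hav : a = v t
    · rw [hav, hSv] at h2
      omega
    · rw [hSne t a hav] at h2
      have := (inv t a).2.1
      omega
  · intro t b
    rw [cartan_symm b]
    refine and_congr_right fun _ => ?_
    by_cases hbv : b = v t
    · simp [hbv]
    · rw [hSne t b hbv, hSv, hvt]
      exact iff_of_true (inv t b).2.1 (hvlt t b hbv)
  · intro t a b ha hb
    rw [hSne t a ha, hSne t b hb]
  · intro t b
    rw [cartan_symm b, hvt, and_comm]
    refine and_congr_left fun _ => ⟨fun hlt hb => ?_, hvlt t b⟩
    rw [hb, hvt] at hlt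
    exact lt_irrefl _ hlt
  · intro t
    simp [hv]
  · intro a
    exact ⟨p a, hpn a, hpinj _ _ ((hpv _).trans (Nat.mod_eq_of_lt (hpn a)))⟩
  · intro s t hs ht hst
    have := congrArg p hst
    rwa [hpv, hpv, Nat.mod_eq_of_lt hs, Nat.mod_eq_of_lt ht] at this

end SinkSequence

/-! ### The steps at which positive roots become simple -/

namespace SinkSequence

variable {I : Type} [Quiver.{0} I] [DecidableEq I] [Fintype I] (Q : SinkSequence I)

/-- The composition of the first `t` simple reflections of the sequence. -/
noncomputable def trans : ℕ → (I → ℤ) → I → ℤ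
  | 0, x => x
  | t + 1, x => reflection (Q.v t) (trans t x)

theorem trans_add (t : ℕ) (x y : I → ℤ) : Q.trans t (x + y) = Q.trans t x + Q.trans t y := by
  induction t with
  | zero => rfl
  | succ t ih => rw [trans, trans, trans, ih, reflection_add]

theorem trans_sum (t : ℕ) (m : ℕ) (x : ℕ → I → ℤ) :
    Q.trans t (∑ s ∈ Finset.range m, x s) = ∑ s ∈ Finset.range m, Q.trans t (x s) :=
  map_sum (AddMonoidHom.mk' (Q.trans t) (Q.trans_add t)) x _

theorem trans_period_add (t : ℕ) (x : I → ℤ) :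
    Q.trans (Q.period + t) x = Q.trans t (Q.trans Q.period x) := by
  induction t with
  | zero => rfl
  | succ t ih => rw [← add_assoc, trans, ih, Q.periodic, trans]

variable (hpos : IsPosForm (cartan I))
include hpos

theorem trans_injective (t : ℕ) : Function.Injective (Q.trans t) := by
  induction t with
  | zero => exact fun x y h => h
  | succ t ih => exact fun x y h => ih (reflection_injective hpos _ h)

theorem form_trans (t : ℕ) (x : I → ℤ) : form (Q.trans t x) (Q.trans t x) = form x x := by
  induction t with
  | zero => rfl
  | succ t ih => rw [trans, form_reflection hpos, ih]

/-- The Coxeter transformation, the product of all simple reflections, has no nonzero fixed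
vector: the coordinate at `v t` is changed in step `t` only, so a fixed vector is fixed by every
simple reflection. -/
theorem eq_zero_of_trans_period_eq {x : I → ℤ} (hx : Q.trans Q.period x = x) : x = 0 := by
  have stable : ∀ t u, t ≤ u → u ≤ Q.period → (∀ s, t ≤ s → s < u → Q.v s ≠ Q.v (t - 1)) →
      Q.trans u x (Q.v (t - 1)) = Q.trans t x (Q.v (t - 1)) := by
    intro t u htu
    induction u, htu using Nat.le_induction with
    | base => exact fun _ _ => rfl
    | succ u htu ih =>
      intro hu hs
      rw [trans, reflection_apply_of_ne (hs u htu (Nat.lt_succ_self u)).symm]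
      exact ih (by omega) fun s h1 h2 => hs s h1 (by omega)
  have fixed : ∀ t, t ≤ Q.period → Q.trans t x = x ∧
      ∀ s < t, form (Pi.single (Q.v s) 1) x = 0 := by
    intro t
    induction t with
    | zero => exact fun _ => ⟨rfl, fun s hs => absurd hs (Nat.not_lt_zero s)⟩
    | succ t ih =>
      intro ht
      obtain ⟨h1, h2⟩ := ih (by omega)
      have h3 := stable (t + 1) Q.period ht le_rfl fun s hs1 hs2 hs =>
        absurd (Q.inj s t hs2 (by omega) hs) (by omega)
      rw [hx, trans, h1, Nat.add_sub_cancel, reflection_eq] at h3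
      have h4 : form (Pi.single (Q.v t) 1) x = 0 := by
        simp only [Pi.sub_apply, Pi.smul_apply, Pi.single_eq_same, smul_eq_mul, mul_one] at h3
        omega
      refine ⟨by rw [trans, h1, reflection_eq, h4, zero_smul, sub_zero], fun s hs => ?_⟩
      rcases Nat.lt_succ_iff_lt_or_eq.1 hs with h | rfl
      exacts [h2 s h, h4]
  by_contra hne
  have h1 := form_self_pos hpos hne
  have h2 : Matrix.mulVec (cartan I) x = 0 := by
    funext a
    obtain ⟨t, ht, rfl⟩ := Q.surj a
    rw [← form_single_left]
    exact (fixed Q.period le_rfl).2 t ht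
  rw [form, h2, dotProduct_zero] at h1
  exact lt_irrefl _ h1

theorem trans_nonneg {x : I → ℤ} (hx : form x x = 2) (h0 : ∀ j, 0 ≤ x j) (t : ℕ)
    (ht : ∀ s < t, Q.trans s x ≠ Pi.single (Q.v s) 1) : ∀ j, 0 ≤ Q.trans t x j := by
  induction t with
  | zero => exact h0
  | succ t ih =>
    exact reflection_nonneg hpos ((Q.form_trans hpos t x).trans hx)
      (ih fun s hs => ht s (by omega)) (ht t (by omega))

/-- Some power of the Coxeter transformation fixes the root, and the sum of the orbit is then a
fixed vector; so the orbit cannot consist of positive roots. -/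
theorem exists_trans_eq_single {x : I → ℤ} (hx : form x x = 2) (h0 : ∀ j, 0 ≤ x j) :
    ∃ t, Q.trans t x = Pi.single (Q.v t) 1 := by
  by_contra! hne
  set c := Q.trans Q.period with hc
  have hcm : ∀ m, c^[m] x = Q.trans (Q.period * m) x := by
    intro m
    have : ∀ y, c^[m] y = Q.trans (Q.period * m) y := by
      induction m with
      | zero => exact fun y => rfl
      | succ m ih =>
        intro y
        rw [Function.iterate_succ_apply, ih, Nat.mul_succ, add_comm, Q.trans_period_add]
    exact this x
  have hmem : ∀ m, c^[m] x ∈ {y : I → ℤ | form y y = 2} := fun m => by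
    rw [hcm]; exact (Q.form_trans hpos _ x).trans hx
  have hnn : ∀ m j, 0 ≤ c^[m] x j := fun m => by
    rw [hcm]; exact Q.trans_nonneg hpos hx h0 _ fun s _ => hne s
  obtain ⟨a, b, hab, heq⟩ : ∃ a b : ℕ, a < b ∧ c^[a] x = c^[b] x := by
    have hni : ¬ Function.Injective fun m => (⟨c^[m] x, hmem m⟩ : {y : I → ℤ | form y y = 2}) := by
      have := (finite_form_eq_two hpos).to_subtype
      exact not_injective_infinite_finite _
    simp only [Function.Injective, not_forall] at hni
    obtain ⟨a, b, h1, h2⟩ := hni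
    have h1' : c^[a] x = c^[b] x := congrArg Subtype.val h1
    rcases lt_or_gt_of_ne h2 with h | h
    exacts [⟨a, b, h, h1'⟩, ⟨b, a, h, h1'.symm⟩]
  obtain ⟨m, rfl⟩ := Nat.exists_eq_add_of_lt hab
  have hper : c^[m + 1] x = x := by
    rw [add_assoc, Function.iterate_add_apply] at heq
    exact ((Q.trans_injective hpos _).iterate a heq).symm
  have hsum : ∑ s ∈ Finset.range (m + 1), c^[s] x = 0 := by
    apply Q.eq_zero_of_trans_period_eq hpos
    rw [Q.trans_sum, Finset.sum_range_succ' (fun s => c^[s] x), Finset.sum_range_succ]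
    congr 1
    · exact Finset.sum_congr rfl fun s _ => (Function.iterate_succ_apply' c s x).symm
    · exact (Function.iterate_succ_apply' c m x).symm.trans hper
  have hx0 : x = 0 := by
    funext j
    have h1 := congrFun hsum j
    rw [Finset.sum_apply] at h1
    exact (Finset.sum_eq_zero_iff_of_nonneg fun s _ => hnn s j).1 h1 0 (by simp)
  simp [hx0, form] at hx

open Classical in
omit hpos in
/-- The step at which a positive root becomes simple, and is made negative by the next
reflection. -/
noncomputable def step (x : I → ℤ) : ℕ :=
  if h : ∃ t, Q.trans t x = Pi.single (Q.v t) 1 then Nat.find h else 0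

theorem trans_step {x : I → ℤ} (hx : form x x = 2) (h0 : ∀ j, 0 ≤ x j) :
    Q.trans (Q.step x) x = Pi.single (Q.v (Q.step x)) 1 := by
  classical
  have h := Q.exists_trans_eq_single hpos hx h0
  rw [step, dif_pos h]
  exact Nat.find_spec h

omit hpos in
theorem trans_ne_of_lt_step {x : I → ℤ} {t : ℕ} (ht : t < Q.step x) :
    Q.trans t x ≠ Pi.single (Q.v t) 1 := by
  classical
  unfold step at ht
  split_ifs at ht with h
  · exact Nat.find_min h ht
  · exact absurd ht (Nat.not_lt_zero t)

theorem trans_nonneg_of_le_step {x : I → ℤ} (hx : form x x = 2) (h0 : ∀ j, 0 ≤ x j) {t : ℕ}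
    (ht : t ≤ Q.step x) : ∀ j, 0 ≤ Q.trans t x j :=
  Q.trans_nonneg hpos hx h0 t fun _ hs => Q.trans_ne_of_lt_step (hs.trans_le ht)

theorem eq_of_step_eq {x y : I → ℤ} (hx : form x x = 2) (hx0 : ∀ j, 0 ≤ x j)
    (hy : form y y = 2) (hy0 : ∀ j, 0 ≤ y j) (h : Q.step x = Q.step y) : x = y :=
  Q.trans_injective hpos (Q.step x) <| by
    rw [Q.trans_step hpos hx hx0, h, Q.trans_step hpos hy hy0]

end SinkSequence

/-! ### Representations of a relation and reflection at a sink -/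

/-- A family of vector spaces with a linear map for every pair of vertices. It stands for a
representation of any quiver without multiple arrows on the vertex set `I`: the relation `R` of
being joined by an arrow is specified separately, and the maps outside `R` are irrelevant. In this
way the orientation can be changed without changing the type of representations. -/
structure RelRep (k : Type) [Field k] (I : Type) where
  V : I → Type
  [addCommGroup : ∀ i, AddCommGroup (V i)]
  [module : ∀ i, Module k (V i)]
  map : ∀ i j : I, V i →ₗ[k] V j

attribute [instance] RelRep.addCommGroup RelRep.module

namespace RelRep

variable {k : Type} [Field k] {I : Type}

/-- The space of homomorphisms of representations of the relation `R`. -/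
def Hom (R : I → I → Prop) (X Y : RelRep k I) : Submodule k (∀ i, X.V i →ₗ[k] Y.V i) where
  carrier := {f | ∀ a b, R a b → f b ∘ₗ X.map a b = Y.map a b ∘ₗ f a}
  add_mem' hf hg a b h := by
    simp only [Pi.add_apply, LinearMap.add_comp, LinearMap.comp_add, hf a b h, hg a b h]
  zero_mem' a b _ := by simp
  smul_mem' c f hf a b h := by
    simp only [Pi.smul_apply, LinearMap.smul_comp, LinearMap.comp_smul, hf a b h]

theorem mem_hom {R : I → I → Prop} {X Y : RelRep k I} {f : ∀ i, X.V i →ₗ[k] Y.V i} :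
    f ∈ Hom R X Y ↔ ∀ a b, R a b → ∀ x, f b (X.map a b x) = Y.map a b (f a x) :=
  forall₃_congr fun _ _ _ => LinearMap.ext_iff

theorem id_mem_hom (R : I → I → Prop) (X : RelRep k I) :
    (fun _ => LinearMap.id) ∈ Hom R X X := fun _ _ _ => rfl

theorem comp_mem_hom {R : I → I → Prop} {X Y Z : RelRep k I} {g : ∀ i, Y.V i →ₗ[k] Z.V i}
    {f : ∀ i, X.V i →ₗ[k] Y.V i} (hg : g ∈ Hom R Y Z) (hf : f ∈ Hom R X Y) :
    (fun i => g i ∘ₗ f i) ∈ Hom R X Z := by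
  rw [mem_hom] at *
  intro a b h x
  simp [hf a b h, hg a b h]

/-- Indecomposability, expressed through the idempotent endomorphisms. -/
def IsIndec (R : I → I → Prop) (X : RelRep k I) : Prop :=
  (∃ i, Nontrivial (X.V i)) ∧ ∀ f ∈ Hom R X X, (∀ i x, f i (f i x) = f i x) →
    (∀ i x, f i x = 0) ∨ ∀ i x, f i x = x

/-- Finite dimensionality with prescribed dimension vector. -/
def HasDimVector (X : RelRep k I) (d : I → ℤ) : Prop :=
  ∀ i, Module.Finite k (X.V i) ∧ (Module.finrank k (X.V i) : ℤ) = d i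

/-- The relation `R'` arises from `R` by reversing all arrows at the sink `i`. -/
structure IsFlip (R R' : I → I → Prop) (i : I) : Prop where
  sink : ∀ b, ¬ R i b
  source : ∀ a, ¬ R' a i
  flip : ∀ b, R' i b ↔ R b i
  ne : ∀ a b, a ≠ i → b ≠ i → (R' a b ↔ R a b)

section Reflection

variable [Fintype I]

open scoped Classical in
/-- The sum of the maps into the vertex `i`. -/
noncomputable def inMap (R : I → I → Prop) (X : RelRep k I) (i : I) :
    (∀ b : {b // R b i}, X.V b) →ₗ[k] X.V i :=
  ∑ b : {b // R b i}, X.map b i ∘ₗ LinearMap.proj b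

/-- The product of the maps out of the vertex `i`, for the arrows reversing those of `R`. -/
def outMap (R : I → I → Prop) (X : RelRep k I) (i : I) :
    X.V i →ₗ[k] ∀ b : {b // R b i}, X.V b :=
  LinearMap.pi fun b => X.map i b

open scoped Classical in
theorem inMap_single (R : I → I → Prop) (X : RelRep k I) (i : I) (b : {b // R b i}) (x : X.V b) :
    inMap R X i (Pi.single b x) = X.map b i x := by
  simp only [inMap, LinearMap.sum_apply, LinearMap.comp_apply, LinearMap.proj_apply]
  rw [Finset.sum_eq_single b]
  · simp
  · intro c _ hc
    simp [hc]
  · simp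

/-- `X` and `X'` correspond to each other under the reflection functors at the sink `i`: they
agree away from `i`, via the mutually inverse maps `e` and `d`, and there is a short exact sequence
`0 → X' i → ⨁ X b → X i → 0` where `b` runs through the neighbours of `i`. -/
structure IsReflected (R : I → I → Prop) (i : I) (X X' : RelRep k I)
    (e : ∀ j, X.V j →ₗ[k] X'.V j) (d : ∀ j, X'.V j →ₗ[k] X.V j) : Prop where
  de : ∀ j ≠ i, ∀ x, d j (e j x) = x
  ed : ∀ j ≠ i, ∀ x, e j (d j x) = x
  comm : ∀ a b, a ≠ i → b ≠ i → R a b → ∀ x, X'.map a b (e a x) = e b (X.map a b x)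
  inj : Function.Injective (outMap R X' i)
  surj : Function.Surjective (inMap R X i)
  exact : ∀ w, inMap R X i w = 0 ↔ ∃ u, ∀ b, outMap R X' i u b = e b (w b)

variable {R R' : I → I → Prop} {i : I} {X X' Y Y' Z Z' : RelRep k I}
  {eX : ∀ j, X.V j →ₗ[k] X'.V j} {dX : ∀ j, X'.V j →ₗ[k] X.V j}
  {eY : ∀ j, Y.V j →ₗ[k] Y'.V j} {dY : ∀ j, Y'.V j →ₗ[k] Y.V j}

/-- Families of maps `f : X → Y` and `f' : X' → Y'` that agree away from `i`. -/
def Related (i : I) (eX : ∀ j, X.V j →ₗ[k] X'.V j) (eY : ∀ j, Y.V j →ₗ[k] Y'.V j)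
    (f : ∀ j, X.V j →ₗ[k] Y.V j) (f' : ∀ j, X'.V j →ₗ[k] Y'.V j) : Prop :=
  ∀ j ≠ i, ∀ x, f' j (eX j x) = eY j (f j x)

theorem inMap_natural {f : ∀ j, X.V j →ₗ[k] Y.V j} (hf : f ∈ Hom R X Y)
    (w : ∀ b : {b // R b i}, X.V b) :
    f i (inMap R X i w) = inMap R Y i fun b => f b (w b) := by
  simp only [inMap, LinearMap.sum_apply, map_sum, LinearMap.comp_apply, LinearMap.proj_apply]
  exact Finset.sum_congr rfl fun b _ => mem_hom.1 hf _ _ b.2 _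

omit [Fintype I] in
theorem outMap_natural (hR : IsFlip R R' i) {f : ∀ j, X.V j →ₗ[k] Y.V j} (hf : f ∈ Hom R' X Y)
    (u : X.V i) (b : {b // R b i}) :
    outMap R Y i (f i u) b = f b (outMap R X i u b) :=
  (mem_hom.1 hf _ _ ((hR.flip _).2 b.2) _).symm

omit [Fintype I] in
theorem IsFlip.ne_of_rel (hR : IsFlip R R' i) (b : {b // R b i}) : b.1 ≠ i := by
  rintro h
  have := b.2
  rw [h] at this
  exact hR.sink i this

theorem eq_zero_of_related_left (hR : IsFlip R R' i) (hX : IsReflected R i X X' eX dX)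
    (hY : IsReflected R i Y Y' eY dY) {f' : ∀ j, X'.V j →ₗ[k] Y'.V j} (hf : f' ∈ Hom R' X' Y')
    (h : Related i eX eY 0 f') : f' = 0 := by
  have h0 : ∀ j ≠ i, ∀ x, f' j x = 0 := fun j hj x => by
    rw [← hX.ed j hj x, h j hj]
    simp
  funext j
  ext x
  by_cases hj : j = i
  · subst hj
    refine hY.inj ?_
    funext b
    rw [outMap_natural hR hf, h0 b (hR.ne_of_rel b)]
    simp
  · exact h0 j hj x

theorem eq_zero_of_related_right (hR : IsFlip R R' i) (hX : IsReflected R i X X' eX dX)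
    (hY : IsReflected R i Y Y' eY dY) {f : ∀ j, X.V j →ₗ[k] Y.V j} (hf : f ∈ Hom R X Y)
    (h : Related i eX eY f 0) : f = 0 := by
  have h0 : ∀ j ≠ i, ∀ x, f j x = 0 := fun j hj x => by
    rw [← hY.de j hj (f j x), ← h j hj]
    simp
  funext j
  ext x
  by_cases hj : j = i
  · subst hj
    obtain ⟨w, rfl⟩ := hX.surj x
    rw [inMap_natural hf]
    have : (fun b : {b // R b j} => f b (w b)) = 0 := funext fun b => h0 b (hR.ne_of_rel b) _
    rw [this]
    simp
  · exact h0 j hj x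

omit [Fintype I] in
theorem Related.sub {f g : ∀ j, X.V j →ₗ[k] Y.V j} {f' g' : ∀ j, X'.V j →ₗ[k] Y'.V j}
    (hf : Related i eX eY f f') (hg : Related i eX eY g g') :
    Related i eX eY (f - g) (f' - g') := fun j hj x => by
  simp [hf j hj, hg j hj]

theorem related_unique_left (hR : IsFlip R R' i) (hX : IsReflected R i X X' eX dX)
    (hY : IsReflected R i Y Y' eY dY) {f g : ∀ j, X.V j →ₗ[k] Y.V j}
    {f' : ∀ j, X'.V j →ₗ[k] Y'.V j} (hf : f ∈ Hom R X Y) (hg : g ∈ Hom R X Y)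
    (h1 : Related i eX eY f f') (h2 : Related i eX eY g f') : f = g := by
  have h := h1.sub h2
  rw [sub_self] at h
  exact sub_eq_zero.1 (eq_zero_of_related_right hR hX hY (Submodule.sub_mem _ hf hg) h)

theorem related_unique_right (hR : IsFlip R R' i) (hX : IsReflected R i X X' eX dX)
    (hY : IsReflected R i Y Y' eY dY) {f : ∀ j, X.V j →ₗ[k] Y.V j}
    {f' g' : ∀ j, X'.V j →ₗ[k] Y'.V j} (hf : f' ∈ Hom R' X' Y') (hg : g' ∈ Hom R' X' Y')
    (h1 : Related i eX eY f f') (h2 : Related i eX eY f g') : f' = g' := by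
  have h := h1.sub h2
  rw [sub_self] at h
  exact sub_eq_zero.1 (eq_zero_of_related_left hR hX hY (Submodule.sub_mem _ hf hg) h)

theorem exists_related_right (hR : IsFlip R R' i) (hX : IsReflected R i X X' eX dX)
    (hY : IsReflected R i Y Y' eY dY) {f : ∀ j, X.V j →ₗ[k] Y.V j} (hf : f ∈ Hom R X Y) :
    ∃ f' ∈ Hom R' X' Y', Related i eX eY f f' := by
  classical
  let f₀ : ∀ j, X'.V j →ₗ[k] Y'.V j := fun j => eY j ∘ₗ f j ∘ₗ dX j
  obtain ⟨l, hl⟩ := (outMap R Y' i).exists_leftInverse_of_injective (LinearMap.ker_eq_bot.2 hY.inj)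
  -- the map induced on the kernels `X' i → Y' i`
  let g : X'.V i →ₗ[k] Y'.V i :=
    l ∘ₗ (LinearMap.pi fun b : {b // R b i} => f₀ b ∘ₗ LinearMap.proj b) ∘ₗ outMap R X' i
  have hg : ∀ u (b : {b // R b i}), outMap R Y' i (g u) b = f₀ b (outMap R X' i u b) := by
    intro u
    have h1 : inMap R X i (fun b => dX b (outMap R X' i u b)) = 0 :=
      (hX.exact _).2 ⟨u, fun b => (hX.ed _ (hR.ne_of_rel b) _).symm⟩
    have h2 := congrArg (f i) h1
    rw [inMap_natural hf, map_zero] at h2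
    obtain ⟨u', hu'⟩ := (hY.exact _).1 h2
    have h3 : outMap R Y' i u' = fun b : {b // R b i} => f₀ b (outMap R X' i u b) := funext hu'
    have h4 : g u = u' := by
      change l (fun b : {b // R b i} => f₀ b (outMap R X' i u b)) = u'
      rw [← h3]
      exact LinearMap.congr_fun hl u'
    intro b
    rw [h4, h3]
  refine ⟨Function.update f₀ i g, mem_hom.2 fun a b hab x => ?_, fun j hj x => ?_⟩
  · by_cases hb : b = i
    · subst hb
      exact absurd hab (hR.source a)
    by_cases ha : a = i
    · subst ha
      rw [Function.update_self, Function.update_of_ne hb]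
      exact (hg x ⟨b, (hR.flip b).1 hab⟩).symm
    · have hab' := (hR.ne a b ha hb).1 hab
      rw [Function.update_of_ne hb, Function.update_of_ne ha]
      obtain ⟨y, rfl⟩ : ∃ y, eX a y = x := ⟨dX a x, hX.ed a ha x⟩
      change eY b (f b (dX b _)) = Y'.map a b (eY a (f a (dX a _)))
      rw [hX.comm a b ha hb hab', hX.de b hb, hX.de a ha, hY.comm a b ha hb hab',
        mem_hom.1 hf a b hab']
  · rw [Function.update_of_ne hj]
    change eY j (f j (dX j _)) = _
    rw [hX.de j hj]

theorem exists_related_left (hR : IsFlip R R' i) (hX : IsReflected R i X X' eX dX)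
    (hY : IsReflected R i Y Y' eY dY) {f' : ∀ j, X'.V j →ₗ[k] Y'.V j} (hf : f' ∈ Hom R' X' Y') :
    ∃ f ∈ Hom R X Y, Related i eX eY f f' := by
  classical
  let f₀ : ∀ j, X.V j →ₗ[k] Y.V j := fun j => dY j ∘ₗ f' j ∘ₗ eX j
  have hf₀ : ∀ j ≠ i, ∀ x, eY j (f₀ j x) = f' j (eX j x) := fun j hj x => hY.ed j hj _
  obtain ⟨r, hr⟩ := (inMap R X i).exists_rightInverse_of_surjective (LinearMap.range_eq_top.2 hX.surj)
  -- the map induced on the cokernels `X i → Y i`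
  let g : X.V i →ₗ[k] Y.V i :=
    inMap R Y i ∘ₗ (LinearMap.pi fun b : {b // R b i} => f₀ b ∘ₗ LinearMap.proj b) ∘ₗ r
  have hg : ∀ w, g (inMap R X i w) = inMap R Y i fun b => f₀ b (w b) := by
    intro w
    have h0 : inMap R X i (r (inMap R X i w) - w) = 0 := by
      rw [map_sub, sub_eq_zero]
      exact LinearMap.congr_fun hr _
    obtain ⟨u, hu⟩ := (hX.exact _).1 h0
    have h1 : inMap R Y i (fun b => f₀ b ((r (inMap R X i w) - w) b)) = 0 :=
      (hY.exact _).2 ⟨f' i u, fun b => by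
        rw [outMap_natural hR hf, hu, hf₀ b (hR.ne_of_rel b)]⟩
    have h2 : (fun b : {b // R b i} => f₀ b ((r (inMap R X i w) - w) b)) =
        (fun b : {b // R b i} => f₀ b (r (inMap R X i w) b)) - fun b : {b // R b i} => f₀ b (w b) := by
      funext b
      simp
    rw [h2, map_sub, sub_eq_zero] at h1
    exact h1
  refine ⟨Function.update f₀ i g, mem_hom.2 fun a b hab x => ?_, fun j hj x => ?_⟩
  · by_cases ha : a = i
    · subst ha
      exact absurd hab (hR.sink b)
    by_cases hb : b = i
    · subst hb
      rw [Function.update_self, Function.update_of_ne ha, ← inMap_single R X b ⟨a, hab⟩ x, hg,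
        ← inMap_single R Y b ⟨a, hab⟩]
      congr 1
      funext c
      by_cases hc : c = ⟨a, hab⟩
      · subst hc
        simp
      · simp [hc]
    · rw [Function.update_of_ne hb, Function.update_of_ne ha, ← hY.de b hb (Y.map a b _),
        ← hY.comm a b ha hb hab, hf₀ a ha, ← mem_hom.1 hf a b ((hR.ne a b ha hb).2 hab),
        hX.comm a b ha hb hab]
      rfl
  · rw [Function.update_of_ne hj, hf₀ j hj]

/-- Reflection functors are fully faithful on representations without the simple at `i` as a
summand. -/
theorem finrank_hom_eq_of_isReflected (hR : IsFlip R R' i) (hX : IsReflected R i X X' eX dX)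
    (hY : IsReflected R i Y Y' eY dY) :
    Module.finrank k (Hom R X Y) = Module.finrank k (Hom R' X' Y') := by
  choose φ hφ hrel using fun f : Hom R X Y => exists_related_right hR hX hY f.2
  have key : ∀ f : Hom R X Y, ∀ f' ∈ Hom R' X' Y', Related i eX eY f.1 f' → φ f = f' :=
    fun f f' h1 h2 => related_unique_right hR hX hY (hφ f) h1 (hrel f) h2
  let L : Hom R X Y →ₗ[k] Hom R' X' Y' :=
    { toFun := fun f => ⟨φ f, hφ f⟩
      map_add' := fun f g => Subtype.ext <| key _ _ (Submodule.add_mem _ (hφ f) (hφ g))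
        fun j hj x => by simp [hrel f j hj, hrel g j hj]
      map_smul' := fun c f => Subtype.ext <| key _ _ (Submodule.smul_mem _ c (hφ f))
        fun j hj x => by simp [hrel f j hj] }
  refine (LinearEquiv.ofBijective L ⟨fun f g h => ?_, fun f' => ?_⟩).finrank_eq
  · have h' : φ f = φ g := congrArg Subtype.val h
    refine Subtype.ext (related_unique_left hR hX hY f.2 g.2 (hrel f) ?_)
    rw [h']
    exact hrel g
  · obtain ⟨f, hf, h⟩ := exists_related_left hR hX hY f'.2
    exact ⟨⟨f, hf⟩, Subtype.ext (key ⟨f, hf⟩ _ f'.2 h)⟩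

omit [Fintype I] in
theorem Related.comp {eZ : ∀ j, Z.V j →ₗ[k] Z'.V j} {f : ∀ j, X.V j →ₗ[k] Y.V j}
    {f' : ∀ j, X'.V j →ₗ[k] Y'.V j} {g : ∀ j, Y.V j →ₗ[k] Z.V j}
    {g' : ∀ j, Y'.V j →ₗ[k] Z'.V j} (hg : Related i eY eZ g g') (hf : Related i eX eY f f') :
    Related i eX eZ (fun j => g j ∘ₗ f j) (fun j => g' j ∘ₗ f' j) := fun j hj x => by
  simp [hf j hj, hg j hj]

theorem isIndec_iff_of_isReflected (hR : IsFlip R R' i) (hX : IsReflected R i X X' eX dX) :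
    IsIndec R X ↔ IsIndec R' X' := by
  have zero_iff : (∃ j, Nontrivial (X.V j)) ↔ ∃ j, Nontrivial (X'.V j) := by
    rw [← not_iff_not]
    push Not
    constructor
    · intro h j
      refine subsingleton_of_forall_eq 0 fun x => ?_
      by_cases hj : j = i
      · subst hj
        refine hX.inj (funext fun b => ?_)
        rw [← hX.ed b (hR.ne_of_rel b) (outMap R X' j x b), Subsingleton.elim (dX b _) 0]
        simp
      · rw [← hX.ed j hj x, Subsingleton.elim (dX j x) 0, map_zero]
    · intro h j
      refine subsingleton_of_forall_eq 0 fun x => ?_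
      by_cases hj : j = i
      · subst hj
        obtain ⟨w, rfl⟩ := hX.surj x
        have : w = 0 := funext fun b => by
          rw [← hX.de b (hR.ne_of_rel b) (w b), Subsingleton.elim (eX b (w b)) 0]
          simp
        rw [this, map_zero]
      · rw [← hX.de j hj x, Subsingleton.elim (eX j x) 0, map_zero]
  have id_rel : Related i eX eX (fun _ => LinearMap.id) (fun _ => LinearMap.id) :=
    fun _ _ _ => rfl
  have zero_rel : Related i eX eX 0 0 := fun _ _ _ => by simp
  refine and_congr zero_iff ⟨fun h f' hf' hid => ?_, fun h f hf hid => ?_⟩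
  · obtain ⟨f, hf, hrel⟩ := exists_related_left hR hX hX hf'
    have hff : (fun j => f' j ∘ₗ f' j) = f' := funext fun j => LinearMap.ext (hid j)
    have hid' : (fun j => f j ∘ₗ f j) = f :=
      related_unique_left hR hX hX (comp_mem_hom hf hf) hf
        (by have := hrel.comp hrel; rwa [hff] at this) hrel
    rcases h f hf fun j x => LinearMap.congr_fun (congrFun hid' j) x with h0 | h1
    · left
      have : f = 0 := funext fun j => LinearMap.ext (h0 j)
      have : f' = 0 := related_unique_right hR hX hX hf' (Submodule.zero_mem _) hrel
        (by rw [this]; exact zero_rel)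
      simp [this]
    · right
      have : f = fun _ => LinearMap.id := funext fun j => LinearMap.ext (h1 j)
      have : f' = fun _ => LinearMap.id := related_unique_right hR hX hX hf' (id_mem_hom _ _) hrel
        (by rw [this]; exact id_rel)
      simp [this]
  · obtain ⟨f', hf', hrel⟩ := exists_related_right hR hX hX hf
    have hff : (fun j => f j ∘ₗ f j) = f := funext fun j => LinearMap.ext (hid j)
    have hid' : (fun j => f' j ∘ₗ f' j) = f' :=
      related_unique_right hR hX hX (comp_mem_hom hf' hf') hf'
        (by have := hrel.comp hrel; rwa [hff] at this) hrel
    rcases h f' hf' fun j x => LinearMap.congr_fun (congrFun hid' j) x with h0 | h1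
    · left
      have : f' = 0 := funext fun j => LinearMap.ext (h0 j)
      have : f = 0 := related_unique_left hR hX hX hf (Submodule.zero_mem _) hrel
        (by rw [this]; exact zero_rel)
      simp [this]
    · right
      have : f' = fun _ => LinearMap.id := funext fun j => LinearMap.ext (h1 j)
      have : f = fun _ => LinearMap.id := related_unique_left hR hX hX hf (id_mem_hom _ _) hrel
        (by rw [this]; exact id_rel)
      simp [this]

end Reflection

end RelRep

/-! ### Construction of reflections -/

namespace RelRep

section Construction

variable {k : Type} [Field k] {I : Type}

/-- Replacing one member of a family of vector spaces. -/
theorem exists_family_replace (V : I → Type) [∀ j, AddCommGroup (V j)] [∀ j, Module k (V j)]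
    (i : I) (A : Type) [AddCommGroup A] [Module k A] :
    ∃ (W : I → Type) (_ : ∀ j, AddCommGroup (W j)) (_ : ∀ j, Module k (W j))
      (e : ∀ j, V j →ₗ[k] W j) (d : ∀ j, W j →ₗ[k] V j)
      (c : ∀ j, W j →ₗ[k] A) (c' : ∀ j, A →ₗ[k] W j),
      (∀ j ≠ i, ∀ x, d j (e j x) = x) ∧ (∀ j ≠ i, ∀ x, e j (d j x) = x) ∧
      (∀ x, c' i (c i x) = x) ∧ ∀ x, c i (c' i x) = x := by
  have h : ∀ j, ∃ (W : Type) (_ : AddCommGroup W) (_ : Module k W)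
      (e : V j →ₗ[k] W) (d : W →ₗ[k] V j) (c : W →ₗ[k] A) (c' : A →ₗ[k] W),
      (j ≠ i → (∀ x, d (e x) = x) ∧ ∀ x, e (d x) = x) ∧
      (j = i → (∀ x, c' (c x) = x) ∧ ∀ x, c (c' x) = x) := by
    intro j
    by_cases hj : j = i
    · exact ⟨A, inferInstance, inferInstance, 0, 0, LinearMap.id, LinearMap.id,
        fun h => absurd hj h, fun _ => ⟨fun _ => rfl, fun _ => rfl⟩⟩
    · exact ⟨V j, inferInstance, inferInstance, LinearMap.id, LinearMap.id, 0, 0,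
        fun _ => ⟨fun _ => rfl, fun _ => rfl⟩, fun h => absurd h hj⟩
  choose W i1 i2 e d c c' h1 h2 using h
  exact ⟨W, i1, i2, e, d, c, c', fun j hj => (h1 j hj).1, fun j hj => (h1 j hj).2,
    (h2 i rfl).1, (h2 i rfl).2⟩

theorem finite_and_finrank_eq_of_inverse {V W : I → Type} [∀ j, AddCommGroup (V j)] [∀ j, Module k (V j)]
    [∀ j, AddCommGroup (W j)] [∀ j, Module k (W j)] {j : I} {n : ℤ}
    (h : Module.Finite k (V j) ∧ (Module.finrank k (V j) : ℤ) = n)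
    {e : V j →ₗ[k] W j} {d : W j →ₗ[k] V j} (h1 : ∀ x, d (e x) = x) (h2 : ∀ x, e (d x) = x) :
    Module.Finite k (W j) ∧ (Module.finrank k (W j) : ℤ) = n := by
  let E : V j ≃ₗ[k] W j := LinearEquiv.ofLinearMap e d (LinearMap.ext h2) (LinearMap.ext h1)
  have := h.1
  exact ⟨Module.Finite.equiv E, by rw [← E.finrank_eq]; exact h.2⟩

variable [Fintype I] {R R' : I → I → Prop} {i : I}

open scoped Classical in
theorem finrank_pi_eq {X : RelRep k I} {x : I → ℤ} (hx : X.HasDimVector x) :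
    Module.Finite k (∀ b : {b // R b i}, X.V b) ∧
    (Module.finrank k (∀ b : {b // R b i}, X.V b) : ℤ) = ∑ b : {b // R b i}, x b := by
  have := fun j => (hx j).1
  refine ⟨inferInstance, ?_⟩
  rw [Module.finrank_pi_fintype]
  push_cast
  exact Finset.sum_congr rfl fun b _ => (hx b).2

open scoped Classical in
/-- The reflection functor at a sink: the space at `i` is replaced by the kernel of the map from
the sum of the neighbouring spaces. -/
theorem exists_isReflected_of_surjective (hR : IsFlip R R' i) {X : RelRep k I}
    (hX : Function.Surjective (inMap R X i)) {x : I → ℤ} (hx : X.HasDimVector x) :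
    ∃ (X' : RelRep k I) (e : ∀ j, X.V j →ₗ[k] X'.V j) (d : ∀ j, X'.V j →ₗ[k] X.V j),
      IsReflected R i X X' e d ∧
      X'.HasDimVector (Function.update x i (∑ b : {b // R b i}, x b - x i)) := by
  obtain ⟨W, i1, i2, e, d, c, c', hde, hed, hcc', hc'c⟩ :=
    exists_family_replace (k := k) X.V i (LinearMap.ker (inMap R X i))
  let X' : RelRep k I :=
    { V := W
      map := fun a b => if a = i then
          (if h : R b i then
            e b ∘ₗ LinearMap.proj (⟨b, h⟩ : {b // R b i}) ∘ₗ (Submodule.subtype _) ∘ₗ c a else 0)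
        else e b ∘ₗ X.map a b ∘ₗ d a }
  have hout : ∀ u (b : {b // R b i}), outMap R X' i u b = e b ((c i u).1 b) := by
    intro u b
    change (if i = i then (if h : R b i then e b ∘ₗ LinearMap.proj (⟨b, h⟩ : {b // R b i}) ∘ₗ
      (Submodule.subtype _) ∘ₗ c i else 0) else e b ∘ₗ X.map i b ∘ₗ d i) u = _
    rw [if_pos rfl, dif_pos b.2]
    rfl
  refine ⟨X', e, d, ⟨hde, hed, ?_, ?_, hX, ?_⟩, ?_⟩
  · intro a b ha hb hab y
    change (if a = i then _ else e b ∘ₗ X.map a b ∘ₗ d a) (e a y) = _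
    rw [if_neg ha]
    simp [hde a ha]
  · intro u u' h
    rw [← hcc' u, ← hcc' u']
    congr 1
    refine Subtype.ext (funext fun b => ?_)
    have h1 := congrFun h b
    rw [hout, hout] at h1
    rw [← hde b (hR.ne_of_rel b) ((c i u).1 b), h1, hde b (hR.ne_of_rel b)]
  · intro w
    constructor
    · intro hw
      exact ⟨c' i ⟨w, hw⟩, fun b => by rw [hout, hc'c]⟩
    · rintro ⟨u, hu⟩
      have : w = (c i u).1 := funext fun b => by
        rw [← hde b (hR.ne_of_rel b) (w b), ← hu b, hout, hde b (hR.ne_of_rel b)]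
      rw [this]
      exact (c i u).2
  · intro j
    by_cases hj : j = i
    · subst hj
      rw [Function.update_self]
      obtain ⟨f1, f2⟩ := finrank_pi_eq (R := R) (i := j) hx
      have h1 := LinearMap.finrank_range_add_finrank_ker (inMap R X j)
      rw [LinearMap.range_eq_top.2 hX, finrank_top] at h1
      have h2 := (hx j).2
      let E : LinearMap.ker (inMap R X j) ≃ₗ[k] W j :=
        LinearEquiv.ofLinearMap (c' j) (c j) (LinearMap.ext hcc') (LinearMap.ext hc'c)
      refine ⟨Module.Finite.equiv E, ?_⟩
      have h3 : Module.finrank k (X'.V j) = _ := E.finrank_eq.symm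
      rw [h3]
      omega
    · rw [Function.update_of_ne hj]
      exact finite_and_finrank_eq_of_inverse (V := X.V) (W := W) (hx j) (hde j hj) (hed j hj)

open scoped Classical in
/-- The reflection functor at a source: the space at `i` is replaced by the cokernel of the map to
the sum of the neighbouring spaces. -/
theorem exists_isReflected_of_injective (hR : IsFlip R R' i) {X' : RelRep k I}
    (hX : Function.Injective (outMap R X' i)) {x : I → ℤ} (hx : X'.HasDimVector x) :
    ∃ (X : RelRep k I) (e : ∀ j, X.V j →ₗ[k] X'.V j) (d : ∀ j, X'.V j →ₗ[k] X.V j),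
      IsReflected R i X X' e d ∧
      X.HasDimVector (Function.update x i (∑ b : {b // R b i}, x b - x i)) := by
  obtain ⟨W, i1, i2, d, e, c, c', hed, hde, hcc', hc'c⟩ :=
    exists_family_replace (k := k) X'.V i
      ((∀ b : {b // R b i}, X'.V b) ⧸ LinearMap.range (outMap R X' i))
  let X : RelRep k I :=
    { V := W
      map := fun a b => if b = i then
          (if h : R a i then
            c' b ∘ₗ Submodule.mkQ _ ∘ₗ
              LinearMap.single k (fun b : {b // R b i} => X'.V b) ⟨a, h⟩ ∘ₗ e a else 0)
        else d b ∘ₗ X'.map a b ∘ₗ e a }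
  have hmap : ∀ (b : {b // R b i}) (y : W b), X.map b i y =
      c' i (Submodule.mkQ _ (Pi.single b (e b y))) := by
    intro b y
    change (if i = i then
          (if h : R b i then
            c' i ∘ₗ Submodule.mkQ _ ∘ₗ
              LinearMap.single k (fun b : {b // R b i} => X'.V b) ⟨b, h⟩ ∘ₗ e b else 0)
        else d i ∘ₗ X'.map b i ∘ₗ e b) y = _
    rw [if_pos rfl, dif_pos b.2]
    rfl
  have hin : ∀ w : ∀ b : {b // R b i}, X.V b, inMap R X i w =
      c' i (Submodule.mkQ _ fun b => e b (w b)) := by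
    intro w
    have h1 : (fun b : {b // R b i} => e b (w b)) = ∑ b : {b // R b i}, Pi.single b (e b (w b)) :=
      (Finset.univ_sum_single _).symm
    rw [h1, map_sum, map_sum]
    simp only [inMap, LinearMap.sum_apply, LinearMap.comp_apply, LinearMap.proj_apply]
    exact Finset.sum_congr rfl fun b _ => hmap b (w b)
  refine ⟨X, e, d, ⟨hde, hed, ?_, hX, ?_, ?_⟩, ?_⟩
  · intro a b ha hb hab y
    change _ = e b ((if b = i then _ else d b ∘ₗ X'.map a b ∘ₗ e a) y)
    rw [if_neg hb]
    simp [hed b hb]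
  · intro y
    obtain ⟨w, hw⟩ := Submodule.mkQ_surjective _ (c i y)
    refine ⟨fun b => d b (w b), ?_⟩
    rw [hin]
    have : (fun b : {b // R b i} => e b (d b (w b))) = w :=
      funext fun b => hed b (hR.ne_of_rel b) _
    rw [this, hw, hcc']
  · intro w
    rw [hin]
    constructor
    · intro h
      have h1 := congrArg (c i) h
      rw [hc'c, map_zero] at h1
      obtain ⟨u, hu⟩ := (Submodule.Quotient.mk_eq_zero _).1 h1
      exact ⟨u, fun b => congrFun hu b⟩
    · rintro ⟨u, hu⟩
      have : Submodule.mkQ (LinearMap.range (outMap R X' i)) (fun b : {b // R b i} => e b (w b)) = 0 :=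
        (Submodule.Quotient.mk_eq_zero _).2 ⟨u, funext hu⟩
      rw [this, map_zero]
  · intro j
    by_cases hj : j = i
    · subst hj
      rw [Function.update_self]
      obtain ⟨f1, f2⟩ := finrank_pi_eq (R := R) (i := j) hx
      have h1 := Submodule.finrank_quotient_add_finrank (LinearMap.range (outMap R X' j))
      rw [LinearMap.finrank_range_of_inj hX] at h1
      have h2 := (hx j).2
      let E : ((∀ b : {b // R b j}, X'.V b) ⧸ LinearMap.range (outMap R X' j)) ≃ₗ[k] W j :=
        LinearEquiv.ofLinearMap (c' j) (c j) (LinearMap.ext hcc') (LinearMap.ext hc'c)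
      refine ⟨Module.Finite.equiv E, ?_⟩
      have h3 : Module.finrank k (X.V j) = _ := E.finrank_eq.symm
      rw [h3]
      omega
    · rw [Function.update_of_ne hj]
      exact finite_and_finrank_eq_of_inverse (V := X'.V) (W := W) (hx j) (hed j hj) (hde j hj)

omit [Fintype I] in
/-- The endomorphism given by an idempotent at the vertex `i` only. -/
theorem IsIndec.eq_zero_or_of_update {R : I → I → Prop} {X : RelRep k I} (hX : IsIndec R X)
    [DecidableEq I] {p : X.V i →ₗ[k] X.V i}
    (hf : Function.update (fun _ => 0) i p ∈ Hom R X X) (hp : ∀ x, p (p x) = p x) :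
    (∀ x, p x = 0) ∨ ∀ j ≠ i, ∀ x : X.V j, x = 0 := by
  have hid : ∀ j x, (Function.update (fun _ => 0) i p : ∀ j, X.V j →ₗ[k] X.V j) j
      ((Function.update (fun _ => 0) i p : ∀ j, X.V j →ₗ[k] X.V j) j x) =
      (Function.update (fun _ => 0) i p : ∀ j, X.V j →ₗ[k] X.V j) j x := by
    intro j x
    by_cases hj : j = i
    · subst hj
      simpa using hp x
    · simp [hj]
  rcases hX.2 _ hf hid with h | h
  · left
    intro x
    simpa using h i x
  · right
    intro j hj x
    have := h j x
    rw [Function.update_of_ne hj] at this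
    exact this.symm

/-- An indecomposable representation that is not concentrated at the sink `i` is generated
at `i` by its neighbours. -/
theorem IsIndec.inMap_surjective (hR : IsFlip R R' i) {X : RelRep k I} (hX : IsIndec R X)
    (hne : ¬ ∀ j ≠ i, ∀ x : X.V j, x = 0) : Function.Surjective (inMap R X i) := by
  classical
  obtain ⟨s, hs⟩ := (LinearMap.range (inMap R X i)).mkQ.exists_rightInverse_of_surjective
    (LinearMap.range_eq_top.2 (Submodule.mkQ_surjective _))
  have hs' : ∀ z, (LinearMap.range (inMap R X i)).mkQ (s z) = z := LinearMap.congr_fun hs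
  have h0 : ∀ z, (LinearMap.range (inMap R X i)).mkQ (inMap R X i z) = 0 := fun z =>
    (Submodule.Quotient.mk_eq_zero _).2 ⟨z, rfl⟩
  have hmem : Function.update (fun _ => 0) i (s ∘ₗ (LinearMap.range (inMap R X i)).mkQ)
      ∈ Hom R X X := by
    rw [mem_hom]
    intro a b hab x
    have ha : a ≠ i := fun h => hR.sink b (h ▸ hab)
    rw [Function.update_of_ne ha]
    by_cases hb : b = i
    · subst hb
      rw [Function.update_self, ← inMap_single R X b ⟨a, hab⟩ x, LinearMap.comp_apply, h0]
      simp
    · rw [Function.update_of_ne hb]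
      simp
  have hid : ∀ x, (s ∘ₗ (LinearMap.range (inMap R X i)).mkQ)
      ((s ∘ₗ (LinearMap.range (inMap R X i)).mkQ) x) =
      (s ∘ₗ (LinearMap.range (inMap R X i)).mkQ) x := by
    intro x
    simp only [LinearMap.comp_apply, hs']
  rcases hX.eq_zero_or_of_update hmem hid with h | h
  · intro y
    have h1 := hs' ((LinearMap.range (inMap R X i)).mkQ y)
    have h2 : s ((LinearMap.range (inMap R X i)).mkQ y) = 0 := h y
    rw [h2, map_zero] at h1
    exact (Submodule.Quotient.mk_eq_zero _).1 h1.symm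
  · exact absurd h hne

omit [Fintype I] in
/-- An indecomposable representation that is not concentrated at the source `i` is cogenerated
at `i` by its neighbours. -/
theorem IsIndec.outMap_injective (hR : IsFlip R R' i) {X : RelRep k I} (hX : IsIndec R' X)
    (hne : ¬ ∀ j ≠ i, ∀ x : X.V j, x = 0) : Function.Injective (outMap R X i) := by
  classical
  obtain ⟨l, hl⟩ := (LinearMap.ker (outMap R X i)).subtype.exists_leftInverse_of_injective
    (Submodule.ker_subtype _)
  have hl' : ∀ z : LinearMap.ker (outMap R X i), l z = z := LinearMap.congr_fun hl
  have hmem : Function.update (fun _ => 0) i ((LinearMap.ker (outMap R X i)).subtype ∘ₗ l)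
      ∈ Hom R' X X := by
    rw [mem_hom]
    intro a b hab x
    have hb : b ≠ i := fun h => hR.source a (h ▸ hab)
    rw [Function.update_of_ne hb]
    by_cases ha : a = i
    · subst ha
      rw [Function.update_self]
      exact (congrFun (l x).2 ⟨b, (hR.flip b).1 hab⟩).symm
    · rw [Function.update_of_ne ha]
      simp
  have hid : ∀ x, ((LinearMap.ker (outMap R X i)).subtype ∘ₗ l)
      (((LinearMap.ker (outMap R X i)).subtype ∘ₗ l) x) =
      ((LinearMap.ker (outMap R X i)).subtype ∘ₗ l) x := by
    intro x
    simp only [LinearMap.comp_apply, Submodule.subtype_apply, hl']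
  rcases hX.eq_zero_or_of_update hmem hid with h | h
  · rw [← LinearMap.ker_eq_bot, Submodule.eq_bot_iff]
    intro x hx
    have h1 := h x
    have h2 := hl' ⟨x, hx⟩
    rw [LinearMap.comp_apply, h2] at h1
    exact h1
  · exact absurd h hne

end Construction

end RelRep

/-! ### Homomorphisms between indecomposable representations -/

section HomDim

open RelRep

variable {I : Type} [Quiver.{0} I] [DecidableEq I] [Fintype I] (Q : SinkSequence I)
  {k : Type} [Field k]

omit [Fintype I] in
theorem SinkSequence.isFlip (t : ℕ) :
    IsFlip (Q.R t) (Q.R (t + 1)) (Q.v t) where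
  sink := Q.sink t
  source := Q.source t
  flip := Q.flip t
  ne := Q.ne t

open scoped Classical in
theorem SinkSequence.update_eq_reflection (hpos : IsPosForm (cartan I)) (t : ℕ) (x : I → ℤ) :
    Function.update x (Q.v t) (∑ b : {b // Q.R t b (Q.v t)}, x b - x (Q.v t)) =
      reflection (Q.v t) x := by
  funext j
  by_cases hj : j = Q.v t
  · subst hj
    have h : ∀ b, cartan I (Q.v t) b * x b = (if b = Q.v t then 2 * x b else 0) -
        if Q.R t b (Q.v t) then x b else 0 := by
      intro b
      rcases eq_or_ne b (Q.v t) with hb | hb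
      · have hr : ¬ Q.R t b (Q.v t) := fun hh => ((Q.nbr t b).1 hh).1 hb
        rw [if_pos hb, if_neg hr, hb, cartan_self hpos, sub_zero]
      · rw [if_neg hb]
        by_cases hc : cartan I (Q.v t) b = 0
        · have hr : ¬ Q.R t b (Q.v t) := fun hh => ((Q.nbr t b).1 hh).2 hc
          simp [hc, hr]
        · rw [if_pos ((Q.nbr t b).2 ⟨hb, hc⟩)]
          have h1 := neg_one_le_cartan hpos hb.symm
          have h2 := cartan_nonpos hb.symm
          have h3 : cartan I (Q.v t) b = -1 := by omega
          rw [h3]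
          ring
    rw [Function.update_self]
    simp only [reflection, Pi.sub_apply, Pi.smul_apply, Pi.single_eq_same, smul_eq_mul, mul_one, h,
      Finset.sum_sub_distrib, Finset.sum_ite_eq', Finset.mem_univ, if_true]
    rw [← Finset.sum_filter, ← Finset.sum_subtype_eq_sum_filter, Finset.subtype_univ]
    ring
  · rw [Function.update_of_ne hj, reflection_apply_of_ne hj]

theorem eq_single_of_concentrated (hpos : IsPosForm (cartan I)) {X : RelRep k I} {x : I → ℤ}
    (hx : X.HasDimVector x) (hq : form x x = 2) {i : I} (h : ∀ j ≠ i, ∀ z : X.V j, z = 0) :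
    x = Pi.single i 1 := by
  have hxi : x = x i • Pi.single i 1 := by
    funext j
    rcases eq_or_ne j i with rfl | hj
    · simp
    · have : Subsingleton (X.V j) := subsingleton_of_forall_eq 0 (h j hj)
      have h1 := (hx j).2
      rw [Module.finrank_zero_of_subsingleton] at h1
      simp [hj, ← h1]
  have h2 := hq
  rw [hxi, form_smul_left, form_smul_right, form_single_single, cartan_self hpos] at h2
  have h3 : 0 ≤ x i := by rw [← (hx i).2]; positivity
  have h4 : x i = 1 := by nlinarith
  rw [hxi, h4, one_smul]

omit [Quiver.{0} I] [Fintype I] in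
theorem subsingleton_of_dim_single {X : RelRep k I} {i : I}
    (hx : X.HasDimVector (Pi.single i 1)) {j : I} (hj : j ≠ i) : Subsingleton (X.V j) := by
  have := (hx j).1
  have h1 := (hx j).2
  rw [Pi.single_eq_of_ne hj] at h1
  exact Module.finrank_zero_iff.1 (by exact_mod_cast h1)

/-- The reflection functor for `v t`, on an indecomposable representation which is not simple. -/
theorem SinkSequence.exists_reflect (hpos : IsPosForm (cartan I)) (t : ℕ) {X : RelRep k I}
    (hX : X.IsIndec (Q.R t)) {x : I → ℤ} (hx : X.HasDimVector x) (hq : form x x = 2)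
    (hne : x ≠ Pi.single (Q.v t) 1) :
    ∃ (X' : RelRep k I) (e : ∀ j, X.V j →ₗ[k] X'.V j) (d : ∀ j, X'.V j →ₗ[k] X.V j),
      IsReflected (Q.R t) (Q.v t) X X' e d ∧ X'.IsIndec (Q.R (t + 1)) ∧
      X'.HasDimVector (reflection (Q.v t) x) := by
  have hs := hX.inMap_surjective (Q.isFlip t) fun h =>
    hne (eq_single_of_concentrated hpos hx hq h)
  obtain ⟨X', e, d, h1, h2⟩ := exists_isReflected_of_surjective (Q.isFlip t) hs hx
  have h3 : X'.HasDimVector (reflection (Q.v t) x) := by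
    rw [← Q.update_eq_reflection hpos]
    convert h2
  exact ⟨X', e, d, h1, (isIndec_iff_of_isReflected (Q.isFlip t) h1).1 hX, h3⟩

theorem SinkSequence.exists_unreflect (hpos : IsPosForm (cartan I)) (t : ℕ) {X' : RelRep k I}
    (hX : X'.IsIndec (Q.R (t + 1))) {x : I → ℤ} (hx : X'.HasDimVector x) (hq : form x x = 2)
    (hne : x ≠ Pi.single (Q.v t) 1) :
    ∃ X : RelRep k I, X.IsIndec (Q.R t) ∧ X.HasDimVector (reflection (Q.v t) x) := by
  have hs := hX.outMap_injective (Q.isFlip t) fun h =>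
    hne (eq_single_of_concentrated hpos hx hq h)
  obtain ⟨X, e, d, h1, h2⟩ := exists_isReflected_of_injective (Q.isFlip t) hs hx
  have h3 : X.HasDimVector (reflection (Q.v t) x) := by
    rw [← Q.update_eq_reflection hpos]
    convert h2
  exact ⟨X, (isIndec_iff_of_isReflected (Q.isFlip t) h1).2 hX, h3⟩

omit [Quiver.{0} I] [Fintype I] in
/-- Homomorphisms out of the simple representation at a sink. -/
theorem finrank_hom_of_simple {R : I → I → Prop} {i : I} (hR : ∀ b, ¬ R i b) {X Y : RelRep k I}
    (hX : X.HasDimVector (Pi.single i 1)) :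
    Module.finrank k (RelRep.Hom R X Y) = Module.finrank k (Y.V i) := by
  have h1 : Module.finrank k (X.V i) = 1 := by
    have := (hX i).2
    rw [Pi.single_eq_same] at this
    exact_mod_cast this
  have := (hX i).1
  let L : RelRep.Hom R X Y →ₗ[k] (X.V i →ₗ[k] Y.V i) :=
    LinearMap.proj i ∘ₗ (RelRep.Hom R X Y).subtype
  have hL : Function.Bijective L := by
    refine ⟨fun f g h => ?_, fun g => ?_⟩
    · refine Subtype.ext (funext fun j => ?_)
      by_cases hj : j = i
      · subst hj
        exact h
      · have := subsingleton_of_dim_single hX hj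
        exact LinearMap.ext fun z => by rw [Subsingleton.elim z 0, map_zero, map_zero]
    · refine ⟨⟨Function.update (fun _ => 0) i g, mem_hom.2 fun a b hab z => ?_⟩, ?_⟩
      · have ha : a ≠ i := fun h => hR b (h ▸ hab)
        have := subsingleton_of_dim_single hX ha
        rw [Subsingleton.elim z 0]
        simp
      · change Function.update (fun j => (0 : X.V j →ₗ[k] Y.V j)) i g i = g
        simp
  rw [(LinearEquiv.ofBijective L hL).finrank_eq, LinearEquiv.finrank_eq
    (LinearEquiv.congrLeft (Y.V i) k (LinearEquiv.ofFinrankEq (X.V i) k (by simp [h1]))),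
    (LinearMap.ringLmapEquivSelf k k (Y.V i)).finrank_eq]

omit [Quiver.{0} I] in
theorem hom_to_simple_eq_bot {R R' : I → I → Prop} {i : I} (hR : IsFlip R R' i)
    {X Y : RelRep k I} (hX : Function.Surjective (inMap R X i))
    (hY : Y.HasDimVector (Pi.single i 1)) : RelRep.Hom R X Y = ⊥ := by
  rw [Submodule.eq_bot_iff]
  intro f hf
  have h0 : ∀ j ≠ i, ∀ z, f j z = 0 := fun j hj z => by
    have := subsingleton_of_dim_single hY hj
    exact Subsingleton.elim _ _
  funext j
  ext z
  by_cases hj : j = i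
  · subst hj
    obtain ⟨w, rfl⟩ := hX z
    rw [inMap_natural hf]
    have : (fun b : {b // R b j} => f b (w b)) = 0 := funext fun b => h0 b (hR.ne_of_rel b) _
    rw [this]
    simp
  · exact h0 j hj z

/-- The dimension of the space of homomorphisms between the indecomposable representations of
dimension vectors `x` and `y`. -/
noncomputable def SinkSequence.homNum (x y : I → ℤ) : ℕ :=
  if Q.step x ≤ Q.step y then (Q.trans (Q.step x) y (Q.v (Q.step x))).toNat else 0

theorem SinkSequence.homNum_eq_zero {x y : I → ℤ} (h : Q.step y < Q.step x) :
    Q.homNum x y = 0 := if_neg (not_le.2 h)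

theorem SinkSequence.homNum_self (hpos : IsPosForm (cartan I)) {x : I → ℤ} (hx : form x x = 2)
    (h0 : ∀ j, 0 ≤ x j) : Q.homNum x x = 1 := by
  rw [homNum, if_pos le_rfl, Q.trans_step hpos hx h0]
  simp

/-- Two indecomposable representations are moved through the sequence of reflection functors until
one of them becomes simple at a sink. -/
theorem SinkSequence.finrank_hom (hpos : IsPosForm (cartan I)) {X Y : RelRep k I}
    (hX : X.IsIndec (Q.R 0)) (hY : Y.IsIndec (Q.R 0)) {x y : I → ℤ} (hXx : X.HasDimVector x)
    (hYy : Y.HasDimVector y) (hx : form x x = 2) (hy : form y y = 2) :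
    Module.finrank k (RelRep.Hom (Q.R 0) X Y) = Q.homNum x y := by
  have hx0 : ∀ j, 0 ≤ x j := fun j => by rw [← (hXx j).2]; positivity
  have hy0 : ∀ j, 0 ≤ y j := fun j => by rw [← (hYy j).2]; positivity
  have main : ∀ t, t ≤ Q.step x → t ≤ Q.step y → ∃ X' Y' : RelRep k I,
      X'.IsIndec (Q.R t) ∧ Y'.IsIndec (Q.R t) ∧ X'.HasDimVector (Q.trans t x) ∧
      Y'.HasDimVector (Q.trans t y) ∧
      Module.finrank k (RelRep.Hom (Q.R 0) X Y) = Module.finrank k (RelRep.Hom (Q.R t) X' Y') := by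
    intro t
    induction t with
    | zero => exact fun _ _ => ⟨X, Y, hX, hY, hXx, hYy, rfl⟩
    | succ t ih =>
      intro h1 h2
      obtain ⟨X', Y', i1, i2, d1, d2, hh⟩ := ih (by omega) (by omega)
      obtain ⟨X₁, eX, dX, rX, jX, mX⟩ := Q.exists_reflect hpos t i1 d1
        ((Q.form_trans hpos t x).trans hx) (Q.trans_ne_of_lt_step (by omega))
      obtain ⟨Y₁, eY, dY, rY, jY, mY⟩ := Q.exists_reflect hpos t i2 d2
        ((Q.form_trans hpos t y).trans hy) (Q.trans_ne_of_lt_step (by omega))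
      exact ⟨X₁, Y₁, jX, jY, mX, mY,
        hh.trans (finrank_hom_eq_of_isReflected (Q.isFlip t) rX rY)⟩
  rcases le_or_gt (Q.step x) (Q.step y) with h | h
  · obtain ⟨X', Y', i1, i2, d1, d2, hh⟩ := main _ le_rfl h
    rw [Q.trans_step hpos hx hx0] at d1
    rw [hh, finrank_hom_of_simple (Q.sink _) d1, homNum, if_pos h, ← (d2 _).2, Int.toNat_natCast]
  · obtain ⟨X', Y', i1, i2, d1, d2, hh⟩ := main _ h.le le_rfl
    rw [Q.trans_step hpos hy hy0] at d2
    rw [hh, hom_to_simple_eq_bot (Q.isFlip _) ?_ d2, finrank_bot, Q.homNum_eq_zero h]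
    exact i1.inMap_surjective (Q.isFlip _) fun hc => Q.trans_ne_of_lt_step h
      (eq_single_of_concentrated hpos d1 ((Q.form_trans hpos _ x).trans hx) hc)

variable (k) in
/-- Starting from a simple representation at the step where the root is simple, the reflection
functors at sources lead back to the given quiver. -/
theorem SinkSequence.exists_indec (hpos : IsPosForm (cartan I)) {x : I → ℤ} (hx : form x x = 2)
    (hx0 : ∀ j, 0 ≤ x j) : ∃ X : RelRep k I, X.IsIndec (Q.R 0) ∧ X.HasDimVector x := by
  have simple : ∃ X : RelRep k I, X.IsIndec (Q.R (Q.step x)) ∧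
      X.HasDimVector (Q.trans (Q.step x) x) := by
    rw [Q.trans_step hpos hx hx0]
    set i := Q.v (Q.step x)
    obtain ⟨W, i1, i2, e, d, c, c', hde, hed, hcc', hc'c⟩ :=
      exists_family_replace (k := k) (fun _ : I => PUnit) i k
    let E : k ≃ₗ[k] W i := LinearEquiv.ofLinearMap (c' i) (c i) (LinearMap.ext hcc')
      (LinearMap.ext hc'c)
    have hsub : ∀ j ≠ i, ∀ z : W j, z = 0 := fun j hj z => by
      rw [← hed j hj z, Subsingleton.elim (d j z) 0, map_zero]
    refine ⟨⟨W, fun _ _ => 0⟩, ⟨⟨i, E.symm.toEquiv.nontrivial⟩, fun f _ hid => ?_⟩, fun j => ?_⟩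
    · -- an endomorphism of the line at `i` is a scalar
      obtain ⟨s, hs⟩ : ∃ s : k, ∀ z : W i, f i z = s • z := by
        refine ⟨c i (f i (c' i 1)), fun z => ?_⟩
        have h1 : z = c i z • c' i 1 := by
          rw [← map_smul, smul_eq_mul, mul_one, hcc']
        calc f i z = c i z • f i (c' i 1) := by rw [← map_smul, ← h1]
          _ = c i z • c' i (c i (f i (c' i 1))) := by rw [hcc']
          _ = c i (f i (c' i 1)) • c' i (c i z) := by
            rw [← map_smul, smul_eq_mul, ← map_smul, smul_eq_mul, mul_comm]
          _ = c i (f i (c' i 1)) • z := by rw [hcc']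
      have h2 : s * s = s := by
        have h3 := hid i (c' i 1)
        rw [hs, hs] at h3
        have h4 := congrArg (c i) h3
        rw [map_smul, map_smul, hc'c] at h4
        simpa using h4
      rcases IsIdempotentElem.iff_eq_zero_or_one.1 h2 with h | h
      · left
        intro j z
        by_cases hj : j = i
        · subst hj
          rw [hs, h, zero_smul]
        · exact hsub j hj _
      · right
        intro j z
        by_cases hj : j = i
        · subst hj
          rw [hs, h, one_smul]
        · rw [hsub j hj z, map_zero]
    · by_cases hj : j = i
      · subst hj
        refine ⟨Module.Finite.equiv E, ?_⟩
        change (Module.finrank k (W i) : ℤ) = _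
        rw [← E.finrank_eq]
        simp
      · have : Subsingleton (W j) := subsingleton_of_forall_eq 0 (hsub j hj)
        refine ⟨(inferInstance : Module.Finite k (W j)), ?_⟩
        change (Module.finrank k (W j) : ℤ) = _
        rw [Module.finrank_zero_of_subsingleton, Pi.single_eq_of_ne hj]
        rfl
  have back : ∀ s, s ≤ Q.step x → ∃ X : RelRep k I, X.IsIndec (Q.R (Q.step x - s)) ∧
      X.HasDimVector (Q.trans (Q.step x - s) x) := by
    intro s
    induction s with
    | zero => exact fun _ => simple
    | succ s ih =>
      intro hs
      obtain ⟨X', h1, h2⟩ := ih (by omega)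
      have e1 : Q.step x - s = Q.step x - (s + 1) + 1 := by omega
      rw [e1] at h1 h2
      set t := Q.step x - (s + 1) with ht
      have h3 := Q.trans_nonneg_of_le_step hpos hx hx0 (t := t) (by omega) (Q.v t)
      obtain ⟨X, h4, h5⟩ := Q.exists_unreflect hpos t h1 h2
        ((Q.form_trans hpos _ x).trans hx) fun hh => by
          have h6 : Q.trans t x = -Pi.single (Q.v t) 1 := by
            rw [← reflection_reflection hpos (Q.v t) (Q.trans t x), ← reflection_single hpos]
            exact congrArg _ hh
          rw [h6] at h3
          simp at h3
      rw [trans, reflection_reflection hpos] at h5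
      exact ⟨X, h4, h5⟩
  simpa [trans] using back (Q.step x) le_rfl

end HomDim

/-! ### Representations of the quiver and of its arrow relation -/

section Transfer

variable {I : Type} [Quiver.{0} I] {k : Type} [Field k]

open scoped Classical in
/-- The representation of the arrow relation given by a representation of a quiver without
multiple arrows. -/
noncomputable def Rep.toRelRep (M : Rep k I) : RelRep k I where
  V := M.V
  map a b := if h : Nonempty (a ⟶ b) then M.map h.some else 0

/-- The representation of a quiver given by a representation of its arrow relation. -/
def RelRep.toRep (X : RelRep k I) : Rep k I where
  V := X.V
  map {a b} _ := X.map a b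

theorem Rep.toRelRep_map [∀ a b : I, Subsingleton (a ⟶ b)] (M : Rep k I) {a b : I} (f : a ⟶ b) :
    M.toRelRep.map a b = M.map f := by
  have h : Nonempty (a ⟶ b) := ⟨f⟩
  have h' : h.some = f := Subsingleton.elim _ _
  exact (dif_pos h).trans (by rw [h'])

theorem Rep.hom_toRelRep [∀ a b : I, Subsingleton (a ⟶ b)] {R : I → I → Prop}
    (hR : ∀ a b, R a b ↔ Nonempty (a ⟶ b)) (M N : Rep k I) :
    RelRep.Hom R M.toRelRep N.toRelRep = Rep.Hom M N := by
  ext f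
  constructor
  · intro hf a b g
    have := hf a b ((hR a b).2 ⟨g⟩)
    rwa [M.toRelRep_map g, N.toRelRep_map g] at this
  · intro hf a b hab
    obtain ⟨g⟩ := (hR a b).1 hab
    rw [M.toRelRep_map g, N.toRelRep_map g]
    exact hf a b g

theorem Rep.IsIndecomposable.toRelRep [∀ a b : I, Subsingleton (a ⟶ b)] {R : I → I → Prop}
    (hR : ∀ a b, R a b ↔ Nonempty (a ⟶ b)) {M : Rep k I} (hM : M.IsIndecomposable) :
    M.toRelRep.IsIndec R := by
  refine ⟨hM.1, fun f hf hid => ?_⟩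
  rw [Rep.hom_toRelRep hR] at hf
  have hf' : ∀ (a b : I) (g : a ⟶ b) (x : M.V a), f b (M.map g x) = M.map g (f a x) :=
    fun a b g x => LinearMap.congr_fun (hf a b g) x
  have hid' : ∀ i, IsIdempotentElem (f i : M.V i →ₗ[k] M.V i) := fun i => LinearMap.ext (hid i)
  have hU : M.IsSubrep fun i => LinearMap.range (f i : M.V i →ₗ[k] M.V i) := by
    rintro a b g _ ⟨_, ⟨x, rfl⟩, rfl⟩
    exact ⟨M.map g x, hf' a b g x⟩
  have hW : M.IsSubrep fun i => LinearMap.ker (f i : M.V i →ₗ[k] M.V i) := by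
    rintro a b g _ ⟨x, hx, rfl⟩
    change f b (M.map g x) = 0
    have hx' : f a x = 0 := hx
    exact (hf' a b g x).trans ((congrArg (M.map g) hx').trans (map_zero _))
  rcases hM.2 _ _ hU hW fun i => LinearMap.IsIdempotentElem.isCompl (hid' i) with h | h
  · left
    intro i x
    have : f i x ∈ LinearMap.range (f i : M.V i →ₗ[k] M.V i) := ⟨x, rfl⟩
    exact (Submodule.mem_bot k).1 ((h i).le this)
  · right
    intro i x
    have : f i x - x ∈ LinearMap.ker (f i : M.V i →ₗ[k] M.V i) := by
      rw [LinearMap.mem_ker]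
      exact (map_sub (f i) _ _).trans (sub_eq_zero.2 (hid i x))
    exact sub_eq_zero.1 ((Submodule.mem_bot k).1 ((h i).le this))

theorem RelRep.IsIndec.toRep {R : I → I → Prop} (hR : ∀ a b, R a b ↔ Nonempty (a ⟶ b))
    {X : RelRep k I} (hX : X.IsIndec R) : X.toRep.IsIndecomposable := by
  refine ⟨hX.1, fun U W hU hW hc => ?_⟩
  let f : ∀ i, X.V i →ₗ[k] X.V i := fun i => (U i).projection (W i) (hc i)
  have hfU : ∀ i x, x ∈ U i → f i x = x := fun i x hx =>
    Submodule.projection_apply_of_mem_left (hc i) hx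
  have hfW : ∀ i x, f i x = 0 ↔ x ∈ W i := fun i x =>
    Submodule.projection_apply_eq_zero_iff (hc i)
  have hfmem : ∀ i x, f i x ∈ U i := fun i x => Submodule.projection_apply_mem (hc i) x
  have hsub : ∀ i x, x - f i x ∈ W i := fun i x => Submodule.sub_projection_mem (hc i) x
  have hf : f ∈ RelRep.Hom R X X := by
    rw [RelRep.mem_hom]
    intro a b hab x
    obtain ⟨g⟩ := (hR a b).1 hab
    have h1 : X.map a b (f a x) ∈ U b := hU a b g ⟨_, hfmem a x, rfl⟩
    have h2 : X.map a b (x - f a x) ∈ W b := hW a b g ⟨_, hsub a x, rfl⟩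
    have h3 := (hfW b _).2 h2
    rw [map_sub, map_sub, sub_eq_zero, hfU b _ h1] at h3
    exact h3
  rcases hX.2 f hf fun i x => hfU i _ (hfmem i x) with h | h
  · left
    intro i
    rw [Submodule.eq_bot_iff]
    intro x hx
    exact (hfU i x hx).symm.trans (h i x)
  · right
    intro i
    rw [Submodule.eq_bot_iff]
    intro x hx
    exact (h i x).symm.trans ((hfW i x).2 hx)

end Transfer

/-! ### Families of indecomposable representations -/

section Family

variable {I : Type} [Quiver.{0} I] [DecidableEq I] [Fintype I]

theorem subsingleton_arrow (hfin : ∀ i j : I, Finite (i ⟶ j)) (hpos : IsPosForm (cartan I))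
    (a b : I) : Subsingleton (a ⟶ b) := by
  have := hfin a b
  rw [← Finite.card_le_one_iff_subsingleton]
  rcases eq_or_ne a b with rfl | hab
  · have h := cartan_self hpos a
    simp only [cartan, if_true] at h
    omega
  · have h := neg_one_le_cartan hpos hab
    simp only [cartan, if_neg hab] at h
    omega

/-- The representation theory of a Dynkin quiver that is needed for counting automorphisms:
positive roots have indecomposable representations over every field, the dimensions of the spaces of
homomorphisms between them do not depend on the field, and homomorphisms between different ones
increase a certain weight. -/
theorem IsDynkin.exists_weight (hQ : IsDynkin I) :
    (∀ (k : Type) [Field k], Nonempty (IndecFamily k I)) ∧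
    ∃ (w : PosRoot I → ℕ) (H : PosRoot I → PosRoot I → ℕ), Function.Injective w ∧
      (∀ β, H β β = 1) ∧ (∀ β γ, w γ < w β → H β γ = 0) ∧
      ∀ (k : Type) [Field k] (F : IndecFamily k I) (β γ : PosRoot I), F.homDim β γ = H β γ := by
  have hpos := hQ.isPosForm
  have hne : Nonempty I := by
    rcases hQ.type_ADE with ⟨n, hn, e, -⟩ | ⟨n, hn, e, -⟩ | ⟨e, -⟩ | ⟨e, -⟩ | ⟨e, -⟩
    · exact ⟨e.symm ⟨0, hn⟩⟩
    · exact ⟨e.symm ⟨0, by omega⟩⟩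
    · exact ⟨e.symm 0⟩
    · exact ⟨e.symm 0⟩
    · exact ⟨e.symm 0⟩
  have hsub := subsingleton_arrow hQ.finite_hom hpos
  obtain ⟨Q⟩ := exists_sinkSequence hQ.finite_hom hpos
  have hq : ∀ β : PosRoot I, form β.1 β.1 = 2 := fun β => β.2.1.form_self hpos
  refine ⟨fun k _ => ?_, fun β => Q.step β.1, fun β γ => Q.homNum β.1 γ.1,
    fun β γ h => ?_, fun β => ?_, fun β γ h => ?_, fun k _ F β γ => ?_⟩
  · choose X hX hd using fun β : PosRoot I => Q.exists_indec k hpos (hq β) β.2.2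
    exact ⟨⟨fun β => (X β).toRep, fun β => (hX β).toRep Q.zero, hd⟩⟩
  · exact Subtype.ext (Q.eq_of_step_eq hpos (hq β) β.2.2 (hq γ) γ.2.2 h)
  · exact Q.homNum_self hpos (hq β) β.2.2
  · exact Q.homNum_eq_zero h
  · have h := Q.finrank_hom hpos ((F.indecomposable β).toRelRep Q.zero)
      ((F.indecomposable γ).toRelRep Q.zero) (F.dimVector β) (F.dimVector γ) (hq β) (hq γ)
    rw [Rep.hom_toRelRep Q.zero] at h
    exact h

theorem IndecFamily.finite_hom {k : Type} [Field k] (F : IndecFamily k I) (β γ : PosRoot I) :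
    Module.Finite k (Rep.Hom (F.M β) (F.M γ)) := by
  have h1 := fun i => (F.dimVector β i).1
  have h2 := fun i => (F.dimVector γ i).1
  infer_instance

theorem IndecFamily.hom_eq_bot_iff {k : Type} [Field k] (F : IndecFamily k I) (β γ : PosRoot I) :
    Rep.Hom (F.M β) (F.M γ) = ⊥ ↔ F.homDim β γ = 0 := by
  have := F.finite_hom β γ
  exact Submodule.finrank_eq_zero.symm

end Family

/-! ### The action of an involution on representations -/

section Twist

variable {I : Type} [Quiver.{0} I] {k : Type} [Field k] (ρ : Involution I)

/-- The pullback of a representation along an involution of the quiver. -/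
def Rep.twist (M : Rep k I) : Rep k I where
  V i := M.V (ρ.perm i)
  map a := M.map (ρ.toPrefunctor.map a)

theorem Rep.IsIndecomposable.twist {M : Rep k I} (hM : M.IsIndecomposable) :
    (M.twist ρ).IsIndecomposable := by
  have hext : ∀ U : ∀ i, Submodule k ((M.twist ρ).V i), ∃ U' : ∀ i, Submodule k (M.V i),
      ∀ i, U' (ρ.perm i) = U i := fun U =>
    ⟨Equiv.piCongrLeft (fun j => Submodule k (M.V j)) ρ.perm U,
      fun i => Equiv.piCongrLeft_apply_apply (fun j => Submodule k (M.V j)) ρ.perm U i⟩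
  have hsub : ∀ (U : ∀ i, Submodule k ((M.twist ρ).V i)) (U' : ∀ i, Submodule k (M.V i)),
      (∀ i, U' (ρ.perm i) = U i) → (M.twist ρ).IsSubrep U → M.IsSubrep U' := by
    intro U U' h hU i j a
    obtain ⟨i, rfl⟩ := ρ.perm.surjective i
    obtain ⟨j, rfl⟩ := ρ.perm.surjective j
    obtain ⟨a, rfl⟩ := ρ.map_surjective i j a
    rw [h i, h j]
    exact hU i j a
  obtain ⟨⟨i, hi⟩, h⟩ := hM
  refine ⟨?_, fun U W hU hW hc => ?_⟩
  · obtain ⟨i, rfl⟩ := ρ.perm.surjective i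
    exact ⟨i, hi⟩
  · obtain ⟨U', hU'⟩ := hext U
    obtain ⟨W', hW'⟩ := hext W
    rcases h U' W' (hsub U U' hU' hU) (hsub W W' hW' hW) fun i => by
      obtain ⟨i, rfl⟩ := ρ.perm.surjective i
      rw [hU', hW']
      exact hc i with h0 | h0
    · exact Or.inl fun i => (hU' i).symm.trans (h0 _)
    · exact Or.inr fun i => (hW' i).symm.trans (h0 _)

theorem Rep.finrank_hom_twist (M N : Rep k I) :
    Module.finrank k (Rep.Hom (M.twist ρ) (N.twist ρ)) = Module.finrank k (Rep.Hom M N) := by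
  let L : Rep.Hom M N →ₗ[k] Rep.Hom (M.twist ρ) (N.twist ρ) :=
    { toFun := fun f => ⟨fun i => f.1 (ρ.perm i), fun i j a => f.2 _ _ (ρ.toPrefunctor.map a)⟩
      map_add' := fun _ _ => rfl
      map_smul' := fun _ _ => rfl }
  refine (LinearEquiv.ofBijective L ⟨fun f g h => Subtype.ext (funext fun i => ?_), fun f => ?_⟩)
    |>.finrank_eq.symm
  · obtain ⟨i, rfl⟩ := ρ.perm.surjective i
    exact congrFun (congrArg Subtype.val h) i
  · let g := Equiv.piCongrLeft (fun j => M.V j →ₗ[k] N.V j) ρ.perm f.1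
    have hg : ∀ i, g (ρ.perm i) = f.1 i := fun i =>
      Equiv.piCongrLeft_apply_apply (fun j => M.V j →ₗ[k] N.V j) ρ.perm f.1 i
    refine ⟨⟨g, fun i j a => ?_⟩, Subtype.ext (funext hg)⟩
    obtain ⟨i, rfl⟩ := ρ.perm.surjective i
    obtain ⟨j, rfl⟩ := ρ.perm.surjective j
    obtain ⟨a, rfl⟩ := ρ.map_surjective i j a
    rw [hg i, hg j]
    exact f.2 i j a

variable [DecidableEq I] [Fintype I]

theorem Involution.act_act (β : PosRoot I) : ρ.act (ρ.act β) = β :=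
  Subtype.ext (funext fun i => congrArg β.1 (ρ.perm_perm i))

/-- The family of indecomposable representations twisted by an involution. -/
def IndecFamily.twist (F : IndecFamily k I) : IndecFamily k I where
  M β := (F.M (ρ.act β)).twist ρ
  indecomposable β := (F.indecomposable (ρ.act β)).twist ρ
  dimVector β i := by
    have h := F.dimVector (ρ.act β) (ρ.perm i)
    have e : (ρ.act β).1 (ρ.perm i) = β.1 i := congrArg β.1 (ρ.perm_perm i)
    rwa [e] at h

theorem IndecFamily.homDim_twist (F : IndecFamily k I) (β γ : PosRoot I) :
    (F.twist ρ).homDim β γ = F.homDim (ρ.act β) (ρ.act γ) :=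
  Rep.finrank_hom_twist ρ _ _

end Twist

/-! ### Counting automorphisms -/

section Count

variable {I : Type} [Quiver.{0} I] [DecidableEq I] [Fintype I] {k : Type} [Field k]
  (F : IndecFamily k I) (mu : PosRoot I → ℕ)

namespace IndecFamily

/-- The summands of `⨁ M(β)^{mu(β)}`. -/
abbrev Index (mu : PosRoot I → ℕ) : Type := Σ β : PosRoot I, Fin (mu β)

/-- Matrix coefficients of an endomorphism of `⨁ M(β)^{mu(β)}`: a matrix of scalars for every
isotypic component, and homomorphisms between the summands belonging to different roots. -/
abbrev Coeff : Type :=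
  (∀ β, Matrix (Fin (mu β)) (Fin (mu β)) k) ×
    ∀ x : {x : Index mu × Index mu // x.1.1 ≠ x.2.1}, Rep.Hom (F.M x.1.2.1) (F.M x.1.1.1)

variable {F mu}
variable [Fintype (PosRoot I)]

/-- The endomorphism with given matrix coefficients. -/
noncomputable def toEnd (D : F.Coeff mu) (i : I) :
    (∀ p : Index mu, (F.M p.1).V i) →ₗ[k] ∀ p : Index mu, (F.M p.1).V i :=
  LinearMap.pi fun p => (∑ d, D.1 p.1 p.2 d • (LinearMap.proj (⟨p.1, d⟩ : Index mu) :
      (∀ p : Index mu, (F.M p.1).V i) →ₗ[k] (F.M p.1).V i)) +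
    ∑ q : {q : Index mu // p.1 ≠ q.1}, (D.2 ⟨(p, q.1), q.2⟩).1 i ∘ₗ LinearMap.proj q.1

theorem toEnd_apply (D : F.Coeff mu) (i : I) (x : ∀ p : Index mu, (F.M p.1).V i) (p : Index mu) :
    toEnd D i x p = (∑ d, D.1 p.1 p.2 d • x ⟨p.1, d⟩) +
      ∑ q : {q : Index mu // p.1 ≠ q.1}, (D.2 ⟨(p, q.1), q.2⟩).1 i (x q.1) := by
  change (∑ d, D.1 p.1 p.2 d • LinearMap.proj (⟨p.1, d⟩ : Index mu) :
      (∀ p : Index mu, (F.M p.1).V i) →ₗ[k] (F.M p.1).V i) x +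
    (∑ q : {q : Index mu // p.1 ≠ q.1}, (D.2 ⟨(p, q.1), q.2⟩).1 i ∘ₗ LinearMap.proj q.1 :
      (∀ p : Index mu, (F.M p.1).V i) →ₗ[k] (F.M p.1).V i) x = _
  rw [LinearMap.sum_apply, LinearMap.sum_apply]
  rfl

theorem toEnd_comm (D : F.Coeff mu) {i j : I} (a : i ⟶ j) (x : ∀ p : Index mu, (F.M p.1).V i) :
    toEnd D j (fun p => (F.M p.1).map a (x p)) = fun p => (F.M p.1).map a (toEnd D i x p) := by
  funext p
  rw [toEnd_apply, toEnd_apply, map_add, map_sum, map_sum]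
  congr 1
  · exact Finset.sum_congr rfl fun d _ => (map_smul _ _ _).symm
  · exact Finset.sum_congr rfl fun q _ =>
      LinearMap.congr_fun ((D.2 ⟨(p, q.1), q.2⟩).2 i j a) (x q.1)

theorem toEnd_single_same (D : F.Coeff mu) (i : I) (β : PosRoot I) (c d : Fin (mu β))
    (y : (F.M β).V i) :
    toEnd D i (Pi.single (⟨β, d⟩ : Index mu) y) ⟨β, c⟩ = D.1 β c d • y := by
  rw [toEnd_apply, Finset.sum_eq_single d, Finset.sum_eq_zero, add_zero]
  · simp
  · rintro ⟨q, hq⟩ -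
    have : q ≠ ⟨β, d⟩ := by
      rintro rfl
      exact hq rfl
    rw [Pi.single_eq_of_ne this, map_zero]
  · intro e _ he
    have : (⟨β, e⟩ : Index mu) ≠ ⟨β, d⟩ := fun h => he (by simpa using h)
    rw [Pi.single_eq_of_ne this, smul_zero]
  · simp

theorem toEnd_single_of_ne (D : F.Coeff mu) (i : I) {p q : Index mu} (h : p.1 ≠ q.1)
    (y : (F.M q.1).V i) :
    toEnd D i (Pi.single q y) p = (D.2 ⟨(p, q), h⟩).1 i y := by
  rw [toEnd_apply, Finset.sum_eq_zero, zero_add, Finset.sum_eq_single ⟨q, h⟩]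
  · simp
  · rintro ⟨r, hr⟩ - hne
    have : r ≠ q := fun h => hne (Subtype.ext h)
    rw [Pi.single_eq_of_ne this, map_zero]
  · simp
  · intro e _
    have : (⟨p.1, e⟩ : Index mu) ≠ q := by
      rintro rfl
      exact h rfl
    rw [Pi.single_eq_of_ne this, smul_zero]

omit [Fintype (PosRoot I)] in
theorem exists_nontrivial (F : IndecFamily k I) (β : PosRoot I) :
    ∃ i, ∃ y : (F.M β).V i, y ≠ 0 := by
  obtain ⟨i, hi⟩ := (F.indecomposable β).1
  exact ⟨i, exists_ne 0⟩

theorem toEnd_injective : Function.Injective (toEnd (F := F) (mu := mu)) := by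
  intro D D' h
  refine Prod.ext (funext fun β => Matrix.ext fun c d => ?_) (funext fun ⟨⟨p, q⟩, hpq⟩ => ?_)
  · obtain ⟨i, y, hy⟩ := F.exists_nontrivial β
    have h1 := toEnd_single_same D i β c d y
    rw [h, toEnd_single_same] at h1
    exact (smul_left_injective k hy h1).symm
  · refine Subtype.ext (funext fun i => LinearMap.ext fun y => ?_)
    have h1 := toEnd_single_of_ne D i hpq y
    rw [h, toEnd_single_of_ne] at h1
    exact h1.symm

/-- If `M(β)` has scalar endomorphisms only, matrix coefficients describe all endomorphisms. -/
theorem exists_toEnd_eq (hend : ∀ β, F.homDim β β = 1)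
    (f : ∀ i, (∀ p : Index mu, (F.M p.1).V i) →ₗ[k] ∀ p : Index mu, (F.M p.1).V i)
    (hf : ∀ (i j : I) (a : i ⟶ j) (x : ∀ p : Index mu, (F.M p.1).V i),
      f j (fun p => (F.M p.1).map a (x p)) = fun p => (F.M p.1).map a (f i x p)) :
    ∃ D : F.Coeff mu, toEnd D = f := by
  let comp : ∀ p q : Index mu, Rep.Hom (F.M q.1) (F.M p.1) := fun p q =>
    ⟨fun i => LinearMap.proj p ∘ₗ f i ∘ₗ LinearMap.single k (fun p : Index mu => (F.M p.1).V i) q,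
      fun i j a => LinearMap.ext fun y => by
        have h1 := congrFun (hf i j a (Pi.single q y)) p
        have h2 : (fun p : Index mu => (F.M p.1).map a
            ((Pi.single q y : ∀ p : Index mu, (F.M p.1).V i) p)) =
            Pi.single q ((F.M q.1).map a y) := by
          funext r
          by_cases hr : r = q
          · subst hr
            simp
          · rw [Pi.single_eq_of_ne hr, Pi.single_eq_of_ne hr, map_zero]
        rw [h2] at h1
        exact h1⟩
  have scalar : ∀ β (g : Rep.Hom (F.M β) (F.M β)), ∃ s : k, ∀ i y, g.1 i y = s • y := by
    intro β g
    let one : Rep.Hom (F.M β) (F.M β) := ⟨fun _ => LinearMap.id, fun _ _ _ => rfl⟩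
    have hone : one ≠ 0 := by
      obtain ⟨i, y, hy⟩ := F.exists_nontrivial β
      intro h
      exact hy (LinearMap.congr_fun (congrFun (congrArg Subtype.val h) i) y)
    obtain ⟨s, hs⟩ := (finrank_eq_one_iff_of_nonzero' one hone).1 (hend β) g
    exact ⟨s, fun i y => by rw [← hs]; rfl⟩
  choose s hs using scalar
  let D : F.Coeff mu := ⟨fun β => Matrix.of fun c d => s β (comp ⟨β, c⟩ ⟨β, d⟩),
    fun x => comp x.1.1 x.1.2⟩
  refine ⟨D, funext fun i => LinearMap.pi_ext fun q y => funext fun p => ?_⟩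
  by_cases hpq : p.1 = q.1
  · obtain ⟨β, c⟩ := p
    obtain ⟨γ, d⟩ := q
    obtain rfl : β = γ := hpq
    rw [toEnd_single_same]
    exact (hs β _ i y).symm
  · rw [toEnd_single_of_ne D i hpq]
    rfl

variable {w : PosRoot I → ℕ} (hw : Function.Injective w)
  (hzero : ∀ β γ, w γ < w β → F.homDim β γ = 0)
include hw hzero

omit [Fintype (PosRoot I)] hw in
theorem coeff_eq_zero (D : F.Coeff mu) {p q : Index mu} (h : p.1 ≠ q.1) (hlt : w p.1 < w q.1)
    (i : I) (y : (F.M q.1).V i) : (D.2 ⟨(p, q), h⟩).1 i y = 0 := by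
  have h1 := (F.hom_eq_bot_iff q.1 p.1).2 (hzero _ _ hlt)
  have h2 := (Submodule.eq_bot_iff _).1 h1 _ (D.2 ⟨(p, q), h⟩).2
  rw [h2]
  rfl

/-- By the weight, endomorphisms are block triangular. So they are injective if the diagonal
blocks are invertible. -/
theorem toEnd_apply_injective {D : F.Coeff mu} (hD : ∀ β, IsUnit (D.1 β)) (i : I) :
    Function.Injective (toEnd D i) := by
  rw [injective_iff_map_eq_zero]
  intro x hx
  have main : ∀ n, ∀ p : Index mu, w p.1 = n → x p = 0 := by
    intro n
    induction n using Nat.strong_induction_on with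
    | _ n ih =>
      rintro ⟨β, c⟩ rfl
      have h1 : ∀ c : Fin (mu β), (∑ d, D.1 β c d • x ⟨β, d⟩ : (F.M β).V i) = 0 := by
        intro c
        have h2 := congrFun hx ⟨β, c⟩
        rw [toEnd_apply, Finset.sum_eq_zero (s := Finset.univ (α := {q : Index mu // β ≠ q.1})),
          add_zero] at h2
        · exact h2
        · rintro ⟨q, hq⟩ -
          rcases lt_or_gt_of_ne (hw.ne hq) with h | h
          · exact coeff_eq_zero hzero D hq h i _
          · rw [ih _ h q rfl, map_zero]
      obtain ⟨B, hB⟩ := (hD β).exists_left_inv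
      calc x ⟨β, c⟩ = (∑ d, (B * D.1 β) c d • x ⟨β, d⟩ : (F.M β).V i) := by
            simp [hB, Matrix.one_apply]
        _ = ∑ e, B c e • (∑ d, D.1 β e d • x ⟨β, d⟩ : (F.M β).V i) := by
            simp only [Matrix.mul_apply, Finset.sum_smul, Finset.smul_sum, mul_smul]
            exact Finset.sum_comm
        _ = 0 := by simp [h1]
  exact funext fun p => main _ p rfl

/-- The converse: an element of the kernel of a diagonal block gives a vector which is mapped into
the sum of the components of higher weight, and this sum is mapped onto itself. -/
theorem isUnit_of_toEnd_injective {D : F.Coeff mu} (hD : ∀ i, Function.Injective (toEnd D i))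
    (β : PosRoot I) : IsUnit (D.1 β) := by
  have hfin := fun γ i => (F.dimVector γ i).1
  by_contra hunit
  rw [Matrix.isUnit_iff_isUnit_det, isUnit_iff_ne_zero, not_not] at hunit
  obtain ⟨v, hv, hv0⟩ := Matrix.exists_mulVec_eq_zero_iff.2 hunit
  obtain ⟨d, hd⟩ := Function.ne_iff.1 hv
  obtain ⟨i, y, hy⟩ := F.exists_nontrivial β
  let U : Submodule k (∀ p : Index mu, (F.M p.1).V i) :=
    { carrier := {x | ∀ p, w p.1 ≤ w β → x p = 0}
      add_mem' := fun hx hy p hp => by rw [Pi.add_apply, hx p hp, hy p hp, add_zero]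
      zero_mem' := fun p _ => rfl
      smul_mem' := fun c x hx p hp => by rw [Pi.smul_apply, hx p hp, smul_zero] }
  have hU : U.map (toEnd D i) = U := by
    refine Submodule.eq_of_le_of_finrank_eq ?_
      (Submodule.equivMapOfInjective _ (hD i) U).finrank_eq.symm
    rintro _ ⟨x, hx, rfl⟩ p hp
    rw [toEnd_apply, Finset.sum_eq_zero, zero_add, Finset.sum_eq_zero]
    · rintro ⟨q, hq⟩ -
      rcases lt_or_ge (w β) (w q.1) with h | h
      · exact coeff_eq_zero hzero D hq (hp.trans_lt h) i _
      · rw [hx q h, map_zero]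
    · intro e _
      rw [hx ⟨p.1, e⟩ hp, smul_zero]
  let x : ∀ p : Index mu, (F.M p.1).V i := ∑ c, Pi.single (⟨β, c⟩ : Index mu) (v c • y)
  have hx : toEnd D i x ∈ U := by
    intro p hp
    simp only [x, map_sum, Finset.sum_apply]
    by_cases hpβ : p.1 = β
    · obtain ⟨γ, c⟩ := p
      obtain rfl : γ = β := hpβ
      simp only [toEnd_single_same, smul_smul, ← Finset.sum_smul]
      have : ∑ e, D.1 γ c e * v e = 0 := congrFun hv0 c
      rw [this, zero_smul]
    · refine Finset.sum_eq_zero fun c _ => ?_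
      rw [toEnd_single_of_ne D i (q := ⟨β, c⟩) hpβ]
      exact coeff_eq_zero hzero D hpβ (lt_of_le_of_ne hp (hw.ne hpβ)) i _
  rw [← hU] at hx
  obtain ⟨z, hz, hzx⟩ := hx
  have h1 : x ⟨β, d⟩ = v d • y := by
    simp only [x, Finset.sum_apply]
    rw [Finset.sum_eq_single d]
    · simp
    · intro c _ hc
      have : (⟨β, d⟩ : Index mu) ≠ ⟨β, c⟩ := fun h => hc (by simpa using h.symm)
      rw [Pi.single_eq_of_ne this]
    · simp
  rw [← hD i hzx, hz ⟨β, d⟩ le_rfl] at h1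
  rcases smul_eq_zero.1 h1.symm with h | h
  exacts [hd h, hy h]

theorem card_aut_eq_card_coeff (hend : ∀ β, F.homDim β β = 1) :
    Nat.card (F.sum mu).Aut = Nat.card {D : F.Coeff mu // ∀ β, IsUnit (D.1 β)} := by
  have hfin := fun γ i => (F.dimVector γ i).1
  have hbij : ∀ D : {D : F.Coeff mu // ∀ β, IsUnit (D.1 β)}, ∀ i,
      Function.Bijective (toEnd D.1 i) := fun D i =>
    have h := toEnd_apply_injective hw hzero D.2 i
    ⟨h, LinearMap.injective_iff_surjective.1 h⟩
  let φ : {D : F.Coeff mu // ∀ β, IsUnit (D.1 β)} → (F.sum mu).Aut := fun D =>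
    ⟨fun i => LinearEquiv.ofBijective (toEnd D.1 i) (hbij D i), fun i j a x => toEnd_comm D.1 a x⟩
  refine (Nat.card_eq_of_bijective φ ⟨fun D D' h => ?_, fun f => ?_⟩).symm
  · refine Subtype.ext (toEnd_injective (funext fun i => LinearMap.ext fun x => ?_))
    exact LinearEquiv.congr_fun (congrFun (congrArg Subtype.val h) i) x
  · obtain ⟨D, hD⟩ := exists_toEnd_eq hend
      (fun i => (f.1 i).toLinearMap) f.2
    have hinj : ∀ i, Function.Injective (toEnd D i) := fun i => by
      rw [hD]
      exact (f.1 i).injective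
    refine ⟨⟨D, isUnit_of_toEnd_injective hw hzero hinj⟩,
      Subtype.ext (funext fun i => LinearEquiv.ext fun x => ?_)⟩
    exact LinearMap.congr_fun (congrFun hD i) x

theorem card_aut [Finite k] (hend : ∀ β, F.homDim β β = 1) :
    Nat.card (F.sum mu).Aut =
      (∏ β, Nat.card (Matrix.GeneralLinearGroup (Fin (mu β)) k)) *
        Nat.card k ^ ∑ β, ∑ γ, mu β * mu γ * if β = γ then 0 else F.homDim γ β := by
  rw [card_aut_eq_card_coeff hw hzero hend]
  let e : {D : F.Coeff mu // ∀ β, IsUnit (D.1 β)} ≃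
      (∀ β, Matrix.GeneralLinearGroup (Fin (mu β)) k) ×
      ∀ x : {x : Index mu × Index mu // x.1.1 ≠ x.2.1}, Rep.Hom (F.M x.1.2.1) (F.M x.1.1.1) :=
    { toFun := fun D => (fun β => (D.2 β).unit, D.1.2)
      invFun := fun A => ⟨(fun β => (A.1 β).1, A.2), fun β => (A.1 β).isUnit⟩
      left_inv := fun D => rfl
      right_inv := fun A => Prod.ext (funext fun β => Units.ext rfl) rfl }
  rw [Nat.card_congr e, Nat.card_prod, Nat.card_pi, Nat.card_pi]
  congr 1
  have hcard : ∀ x : {x : Index mu × Index mu // x.1.1 ≠ x.2.1},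
      Nat.card (Rep.Hom (F.M x.1.2.1) (F.M x.1.1.1)) =
        Nat.card k ^ F.homDim x.1.2.1 x.1.1.1 := fun x => by
    have := F.finite_hom x.1.2.1 x.1.1.1
    exact Module.natCard_eq_pow_finrank
  rw [Finset.prod_congr rfl fun x _ => hcard x, Finset.prod_pow_eq_pow_sum]
  congr 1
  have hsum : ∑ x : {x : Index mu × Index mu // x.1.1 ≠ x.2.1}, F.homDim x.1.2.1 x.1.1.1 =
      ∑ x : Index mu × Index mu, if x.1.1 ≠ x.2.1 then F.homDim x.2.1 x.1.1 else 0 := by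
    rw [← Finset.sum_filter, ← Finset.sum_subtype_eq_sum_filter, Finset.subtype_univ]
  rw [hsum]
  simp only [Fintype.sum_prod_type, Fintype.sum_sigma, Finset.sum_const, Finset.card_univ,
    Fintype.card_fin, smul_eq_mul, ite_not, Finset.mul_sum, mul_assoc]

end IndecFamily

end Count

/-! ### The explicit Laurent polynomials -/

section Laurent

open LaurentPolynomial

theorem T_sub_mul_qInt (r : ℕ) : (T 1 - T (-1)) * qInt r = T r - T (-r) := by
  have h : ∀ i ∈ Finset.range r, (T 1 - T (-1) : ℤ[T;T⁻¹]) * T ((r : ℤ) - 1 - 2 * i) =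
      T ((r : ℤ) - 2 * i) - T ((r : ℤ) - 2 * (i + 1 : ℕ)) := by
    intro i _
    rw [sub_mul, ← T_add, ← T_add]
    push_cast
    congr 2 <;> ring
  rw [qInt, Finset.mul_sum, Finset.sum_congr rfl h,
    Finset.sum_range_sub' (fun i : ℕ => (T ((r : ℤ) - 2 * i) : ℤ[T;T⁻¹]))]
  congr 2
  ring

theorem T_sum {ι : Type*} (s : Finset ι) (f : ι → ℤ) :
    (T (∑ i ∈ s, f i) : ℤ[T;T⁻¹]) = ∏ i ∈ s, T (f i) := by
  classical
  induction s using Finset.induction_on with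
  | empty => simp
  | insert a s ha ih => rw [Finset.sum_insert ha, Finset.prod_insert ha, T_add, ih]

theorem mul_three_mul_sub_one_div_two (m : ℕ) :
    (m : ℤ) * (3 * m - 1) / 2 = ∑ i ∈ Finset.range m, (3 * (i : ℤ) + 1) := by
  have h : (m : ℤ) * (3 * m - 1) = 2 * ∑ i ∈ Finset.range m, (3 * (i : ℤ) + 1) := by
    induction m with
    | zero => simp
    | succ m ih =>
      rw [Finset.sum_range_succ, mul_add, ← ih]
      push_cast
      ring
  rw [h]
  exact Int.mul_ediv_cancel_left _ (by norm_num)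

theorem rootAutPoly_eq (m : ℕ) :
    rootAutPoly m = ∏ i ∈ Finset.range m, (T (2 * (i : ℤ)) * (T (2 * ((i : ℤ) + 1)) - 1)) := by
  have h : (T 1 - T (-1) : ℤ[T;T⁻¹]) ^ m = ∏ i ∈ Finset.range m, (T 1 - T (-1)) := by simp
  rw [rootAutPoly, mul_three_mul_sub_one_div_two, T_sum, h, qFact, mul_assoc,
    ← Finset.prod_mul_distrib, ← Finset.prod_mul_distrib]
  refine Finset.prod_congr rfl fun i _ => ?_
  rw [T_sub_mul_qInt, mul_sub, mul_sub, ← T_add, ← T_add, ← T_add, mul_one]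
  push_cast
  congr 2 <;> ring

theorem rootAutPoly_zero : rootAutPoly 0 = 1 := by simp [rootAutPoly_eq]

theorem eval₂_T_two_mul {x : ℝˣ} {q : ℝ} (hx : (x : ℝ) ^ 2 = q) (n : ℕ) :
    eval₂ (Int.castRingHom ℝ) x (T (2 * (n : ℤ))) = q ^ n := by
  rw [eval₂_T, ← hx, ← pow_mul]
  have : (2 * (n : ℤ)) = ((2 * n : ℕ) : ℤ) := by push_cast; ring
  rw [this, zpow_natCast, Units.val_pow_eq_pow_val]

/-- The Laurent polynomial of a multiple of a root counts invertible matrices. -/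
theorem eval₂_rootAutPoly (k : Type) [Field k] [Finite k] {x : ℝˣ}
    (hx : (x : ℝ) ^ 2 = Nat.card k) (m : ℕ) :
    eval₂ (Int.castRingHom ℝ) x (rootAutPoly m) =
      Nat.card (Matrix.GeneralLinearGroup (Fin m) k) := by
  have := Fintype.ofFinite k
  have hq : 1 ≤ Nat.card k := Nat.card_pos
  have h1 : ∀ i : ℕ, eval₂ (Int.castRingHom ℝ) x (T (2 * (i : ℤ)) * (T (2 * ((i : ℤ) + 1)) - 1)) =
      (Nat.card k : ℝ) ^ i * ((Nat.card k : ℝ) ^ (i + 1) - 1) := by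
    intro i
    have h2 := eval₂_T_two_mul hx (i + 1)
    push_cast at h2
    rw [map_mul, map_sub, map_one, eval₂_T_two_mul hx, h2]
  rw [rootAutPoly_eq, map_prod, Finset.prod_congr rfl fun i _ => h1 i, Finset.prod_mul_distrib,
    ← Finset.prod_range_reflect (fun i => (Nat.card k : ℝ) ^ (i + 1) - 1),
    ← Finset.prod_mul_distrib, Matrix.card_GL_field, ← Nat.card_eq_fintype_card,
    Finset.prod_range, Nat.cast_prod]
  refine Finset.prod_congr rfl fun i _ => ?_
  have hi : (i : ℕ) + (m - 1 - i + 1) = m := by omega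
  rw [Nat.cast_sub (Nat.pow_le_pow_right hq i.2.le), mul_sub, ← pow_add, hi, mul_one]
  push_cast
  rfl

/-- The unit `2` of the reals; values at `2` fix signs. -/
noncomputable def unitTwo : ℝˣ := Units.mk0 2 two_ne_zero

theorem eval₂_T_pos (n : ℤ) : 0 < eval₂ (Int.castRingHom ℝ) unitTwo (T n) := by
  rw [eval₂_T, Units.val_zpow_eq_zpow_val]
  exact zpow_pos (by norm_num [unitTwo]) _

theorem eval₂_rootAutPoly_pos (m : ℕ) :
    0 < eval₂ (Int.castRingHom ℝ) unitTwo (rootAutPoly m) := by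
  have hx : ((unitTwo : ℝˣ) : ℝ) ^ 2 = 4 := by norm_num [unitTwo]
  rw [rootAutPoly_eq, map_prod]
  refine Finset.prod_pos fun i _ => ?_
  have h2 := eval₂_T_two_mul hx (i + 1)
  push_cast at h2
  rw [map_mul, map_sub, map_one, h2]
  refine mul_pos (eval₂_T_pos _) (sub_pos.2 (one_lt_pow₀ (by norm_num) (by omega)))

/-- A Laurent polynomial is determined by its values at the square roots of the primes. -/
theorem eq_of_eval₂_sqrt_prime {a b : ℤ[T;T⁻¹]}
    (h : ∀ p : ℕ, p.Prime → ∀ x : ℝˣ, (x : ℝ) ^ 2 = p →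
      eval₂ (Int.castRingHom ℝ) x a = eval₂ (Int.castRingHom ℝ) x b) : a = b := by
  obtain ⟨n, f, hf⟩ := exists_T_pow (a - b)
  have hroot : ∀ p : ℕ, p.Prime → (f.map (Int.castRingHom ℝ)).IsRoot (Real.sqrt p) := by
    intro p hp
    have hp0 : (0 : ℝ) < p := by exact_mod_cast hp.pos
    let x : ℝˣ := Units.mk0 (Real.sqrt p) (Real.sqrt_ne_zero'.2 hp0)
    have h1 := congrArg (eval₂ (Int.castRingHom ℝ) x) hf
    rw [eval₂_toLaurent, map_mul, map_sub, h p hp x (Real.sq_sqrt hp0.le), sub_self, zero_mul] at h1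
    rw [Polynomial.IsRoot, Polynomial.eval_map]
    exact h1
  have hinf : {y | (f.map (Int.castRingHom ℝ)).IsRoot y}.Infinite := by
    refine (Nat.infinite_setOfPred_prime.image (f := fun p : ℕ => Real.sqrt p) ?_).mono ?_
    · intro p _ p' _ hpp
      have := (Real.sqrt_inj (Nat.cast_nonneg p) (Nat.cast_nonneg p')).1 hpp
      exact_mod_cast this
    · rintro _ ⟨p, hp, rfl⟩
      exact hroot p hp
  have hf0 : f = 0 := by
    have := Polynomial.eq_zero_of_infinite_isRoot _ hinf
    exact (Polynomial.map_eq_zero_iff (Int.cast_injective (α := ℝ))).1 this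
  rw [hf0, map_zero] at hf
  have h2 := (isUnit_T (R := ℤ) n).mul_left_eq_zero.1 hf.symm
  exact sub_eq_zero.1 h2

end Laurent

/-! ### Automorphism polynomials -/

section AutPoly

open LaurentPolynomial

variable {I : Type} [Quiver.{0} I] [DecidableEq I] [Fintype I] [Fintype (PosRoot I)]

/-- The exponent of `q` contributed by homomorphisms between different roots to the number of
automorphisms, where `H β γ` are the dimensions of the spaces of homomorphisms. -/
def offDiag (H : PosRoot I → PosRoot I → ℕ) (mu : PosRoot I → ℕ) : ℕ :=
  ∑ β, ∑ γ, mu β * mu γ * if β = γ then 0 else H γ β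

/-- The automorphism polynomial, expressed through the dimensions of spaces of homomorphisms. -/
noncomputable def autPoly (H : PosRoot I → PosRoot I → ℕ) (mu : PosRoot I → ℕ) : ℤ[T;T⁻¹] :=
  T (2 * (offDiag H mu : ℤ)) * ∏ β, rootAutPoly (mu β)

theorem autPoly_single (H : PosRoot I → PosRoot I → ℕ) (γ : PosRoot I) (m : ℕ) :
    autPoly H (Pi.single γ m) = rootAutPoly m := by
  have h0 : offDiag H (Pi.single γ m) = 0 := by
    refine Finset.sum_eq_zero fun β _ => Finset.sum_eq_zero fun β' _ => ?_
    split_ifs with h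
    · simp
    · by_cases hβ : β = γ
      · have : β' ≠ γ := fun h' => h (hβ.trans h'.symm)
        simp [this]
      · simp [hβ]
  rw [autPoly, h0, Finset.prod_eq_single γ]
  · simp
  · intro β _ hβ
    rw [Pi.single_eq_of_ne hβ, rootAutPoly_zero]
  · simp

theorem isAutPoly_autPoly (hex : ∀ (k : Type) [Field k], Nonempty (IndecFamily k I))
    {w : PosRoot I → ℕ} {H : PosRoot I → PosRoot I → ℕ} (hw : Function.Injective w)
    (hself : ∀ β, H β β = 1) (hzero : ∀ β γ, w γ < w β → H β γ = 0)
    (hH : ∀ (k : Type) [Field k] (F : IndecFamily k I) (β γ : PosRoot I), F.homDim β γ = H β γ)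
    (mu : PosRoot I → ℕ) : IsAutPoly mu (autPoly H mu) := by
  intro k _ _
  refine ⟨hex k, fun F x hx => ?_⟩
  rw [F.card_aut hw (fun β γ h => (hH k F β γ).trans (hzero β γ h))
    (fun β => (hH k F β β).trans (hself β)), autPoly, map_mul, map_prod, eval₂_T_two_mul hx,
    Finset.prod_congr rfl fun β _ => eval₂_rootAutPoly k hx (mu β), mul_comm]
  push_cast
  simp only [hH]
  rfl

omit [Fintype (PosRoot I)] in
theorem isAutPoly_unique {mu : PosRoot I → ℕ} {a b : ℤ[T;T⁻¹]} (ha : IsAutPoly mu a)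
    (hb : IsAutPoly mu b) : a = b := by
  refine eq_of_eval₂_sqrt_prime fun p hp x hx => ?_
  have := Fact.mk hp
  have hx' : (x : ℝ) ^ 2 = Nat.card (ZMod p) := by rw [hx, Nat.card_zmod]
  obtain ⟨⟨F⟩, h1⟩ := ha (ZMod p)
  rw [← h1 F x hx', (hb (ZMod p)).2 F x hx']

end AutPoly

/-! ### Orderings compatible with an involution -/

section Ordering

variable {I : Type} [Quiver.{0} I] [DecidableEq I] [Fintype I] {k : Type} [Field k]
  (ρ : Involution I) {F : IndecFamily k I}

/-- The orbit of a positive root, as a part of a paired list. -/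
def Involution.orbit (γ : PosRoot I) : List (PosRoot I) :=
  if ρ.act γ = γ then [γ] else [γ, ρ.act γ]

theorem Involution.mem_orbit {γ β : PosRoot I} : β ∈ ρ.orbit γ ↔ β = γ ∨ β = ρ.act γ := by
  unfold orbit
  split_ifs with h
  · simp [h]
  · simp

@[to_additive]
theorem Involution.prod_orbit {A : Type} [CommMonoid A] (g : PosRoot I → A) {γ : PosRoot I}
    (hg : ρ.act γ = γ → g γ = 1) : ((ρ.orbit γ).map g).prod = g γ * g (ρ.act γ) := by
  unfold orbit
  split_ifs with h
  · simp [h, hg h]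
  · simp

theorem Involution.pairedList_eq {N : ℕ} (β : Fin N → PosRoot I) :
    ρ.pairedList β = (List.ofFn β).flatMap ρ.orbit := rfl

/-- A product over all positive roots whose factors are trivial at fixed roots and outside a paired
list, along that list. -/
@[to_additive]
theorem Involution.prod_pairedList [Fintype (PosRoot I)] {A : Type} [CommMonoid A]
    (g : PosRoot I → A) (hg : ∀ γ, ρ.act γ = γ → g γ = 1) {N : ℕ} {β : Fin N → PosRoot I}
    (h1 : (ρ.pairedList β).Nodup) (h2 : ∀ γ, γ ∉ ρ.pairedList β → g γ = 1) :
    ∏ γ, g γ = ∏ j, (g (β j) * g (ρ.act (β j))) := by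
  have e1 : ∏ γ, g γ = ∏ γ ∈ (ρ.pairedList β).toFinset, g γ :=
    (Finset.prod_subset (Finset.subset_univ _) fun γ _ hγ =>
      h2 γ fun h => hγ (List.mem_toFinset.2 h)).symm
  rw [e1, List.prod_toFinset g h1, ρ.pairedList_eq, List.map_flatMap, List.flatMap_def,
    List.prod_flatten, List.map_map, List.map_ofFn, List.prod_ofFn]
  exact Finset.prod_congr rfl fun j _ => ρ.prod_orbit g (hg _)

/-- Ordering by the sum of the weights over the orbits is compatible with the involution. -/
theorem exists_admissible [Fintype (PosRoot I)] {w : PosRoot I → ℕ} (hw : Function.Injective w)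
    (hzero : ∀ β γ, w γ < w β → F.homDim β γ = 0)
    (hinv : ∀ β γ, F.homDim (ρ.act β) (ρ.act γ) = F.homDim β γ) {S : Set (PosRoot I)}
    (hS : ρ.nonfixed ⊆ S) :
    ∃ (N : ℕ) (β : Fin N → PosRoot I), F.IsAdmissible S (ρ.pairedList β) := by
  classical
  let φ : PosRoot I → ℕ := fun β => w β + w (ρ.act β)
  have hφ : ∀ β, φ (ρ.act β) = φ β := fun β => by
    simp only [φ, ρ.act_act]
    exact add_comm _ _
  have hφlt : ∀ β γ, β ≠ γ → φ γ ≤ φ β → Rep.Hom (F.M β) (F.M γ) = ⊥ := by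
    intro β γ hne hle
    rw [F.hom_eq_bot_iff]
    by_contra h
    have h1 : w β < w γ := lt_of_le_of_ne (not_lt.1 fun hlt => h (hzero _ _ hlt)) (hw.ne hne)
    have h2 : w (ρ.act β) ≤ w (ρ.act γ) := not_lt.1 fun hlt =>
      h ((hinv β γ).symm.trans (hzero _ _ hlt))
    simp only [φ] at hle
    omega
  have hφorb : ∀ {γ β}, β ∈ ρ.orbit γ → φ β = φ γ := by
    intro γ β h
    rcases ρ.mem_orbit.1 h with rfl | rfl
    exacts [rfl, hφ γ]
  -- the representative of smaller weight is taken from each orbit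
  let l₀ : List (PosRoot I) :=
    (Finset.univ.filter fun β => β ∈ S ∧ w β ≤ w (ρ.act β)).toList
  let l := l₀.insertionSort fun β γ => φ β ≤ φ γ
  have hstd1 : Std.Total fun β γ : PosRoot I => φ β ≤ φ γ := ⟨fun _ _ => le_total _ _⟩
  have hstd2 : IsTrans (PosRoot I) fun β γ => φ β ≤ φ γ := ⟨fun _ _ _ => le_trans⟩
  have hsorted : l.Pairwise fun β γ => φ β ≤ φ γ := List.pairwise_insertionSort _ _
  have hperm : l.Perm l₀ := List.perm_insertionSort _ _
  have hnodup : l.Nodup := hperm.nodup_iff.2 (Finset.nodup_toList _)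
  have hmem : ∀ β, β ∈ l ↔ β ∈ S ∧ w β ≤ w (ρ.act β) := fun β => by
    rw [hperm.mem_iff]
    simp [l₀]
  have hdisj : ∀ β ∈ l, ∀ γ ∈ l, β ≠ γ → ∀ x ∈ ρ.orbit β, ∀ y ∈ ρ.orbit γ, x ≠ y := by
    intro β hβ γ hγ hne x hx y hy hxy
    have hγβ : γ = ρ.act β := by
      rcases ρ.mem_orbit.1 hx with rfl | rfl <;> rcases ρ.mem_orbit.1 hy with rfl | rfl
      · exact absurd hxy hne
      · rw [hxy, ρ.act_act]
      · exact hxy.symm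
      · exact absurd (by rw [← ρ.act_act β, hxy, ρ.act_act]) hne
    have h1 := ((hmem β).1 hβ).2
    have h2 := ((hmem γ).1 hγ).2
    rw [hγβ, ρ.act_act] at h2
    rw [← hγβ] at h1 h2
    exact hne (hw (le_antisymm h1 h2))
  refine ⟨l.length, l.get, ?_⟩
  rw [IndecFamily.IsAdmissible, ρ.pairedList_eq, List.ofFn_get]
  refine ⟨List.nodup_flatMap.2 ⟨fun β _ => ?_, ?_⟩, fun β => ?_,
    List.pairwise_flatMap.2 ⟨fun β _ => ?_, ?_⟩⟩
  · unfold Involution.orbit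
    split_ifs with h
    · simp
    · simpa using fun h' => h h'.symm
  · refine hnodup.imp_of_mem fun {β γ} hβ hγ hne x hx hy => ?_
    exact hdisj β hβ γ hγ hne x hx x hy rfl
  · rw [List.mem_flatMap]
    constructor
    · rintro ⟨γ, hγ, hβ⟩
      have hγS := ((hmem γ).1 hγ).1
      rcases ρ.mem_orbit.1 hβ with rfl | rfl
      · exact hγS
      · by_cases hfix : ρ.act γ = γ
        · rwa [hfix]
        · refine hS fun h => hfix ?_
          rw [ρ.act_act] at h
          exact h.symm
    · intro hβ
      rcases le_total (w β) (w (ρ.act β)) with h | h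
      · exact ⟨β, (hmem β).2 ⟨hβ, h⟩, ρ.mem_orbit.2 (Or.inl rfl)⟩
      · refine ⟨ρ.act β, (hmem _).2 ⟨?_, by rwa [ρ.act_act]⟩,
          ρ.mem_orbit.2 (Or.inr (ρ.act_act β).symm)⟩
        by_cases hfix : ρ.act β = β
        · rwa [hfix]
        · refine hS fun h' => hfix ?_
          rw [ρ.act_act] at h'
          exact h'.symm
  · unfold Involution.orbit
    split_ifs with h
    · simp
    · simpa using hφlt _ _ h (hφ β).ge
  · refine (hsorted.and hnodup).imp_of_mem fun {β γ} hβ hγ hle x hx y hy => ?_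
    refine hφlt _ _ (hdisj β hβ γ hγ hle.2 x hx y hy).symm ?_
    rw [hφorb hx, hφorb hy]
    exact hle.1

end Ordering

/-! ### The square root of the automorphism polynomial -/

section SquareRoot

open LaurentPolynomial

variable {I : Type} [Quiver.{0} I] [DecidableEq I] [Fintype I] {k : Type} [Field k]
  (ρ : Involution I) {F : IndecFamily k I}

theorem IndecFamily.IsAdmissible.homDim_eq_zero {S : Set (PosRoot I)} {N : ℕ}
    {β : Fin N → PosRoot I} (h : F.IsAdmissible S (ρ.pairedList β)) {i j : Fin N} (hij : i < j)
    {x y : PosRoot I} (hx : x ∈ ρ.orbit (β i)) (hy : y ∈ ρ.orbit (β j)) : F.homDim y x = 0 := by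
  have h1 := h.2.2
  rw [ρ.pairedList_eq, List.pairwise_flatMap, List.pairwise_ofFn] at h1
  exact (F.hom_eq_bot_iff _ _).1 (h1.2 hij x hx y hy)

theorem IndecFamily.IsAdmissible.homDim_act_self {S : Set (PosRoot I)} {N : ℕ}
    {β : Fin N → PosRoot I} (h : F.IsAdmissible S (ρ.pairedList β)) (i : Fin N)
    (hne : ρ.act (β i) ≠ β i) : F.homDim (ρ.act (β i)) (β i) = 0 := by
  have h1 := h.2.2
  rw [ρ.pairedList_eq, List.pairwise_flatMap] at h1
  have h2 := h1.1 (β i) (List.mem_ofFn.2 ⟨i, rfl⟩)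
  rw [Involution.orbit, if_neg hne] at h2
  refine (F.hom_eq_bot_iff _ _).1 ?_
  simpa using h2

/-- The involution pairs the homomorphisms between different roots, and an admissible ordering
leaves only those from an earlier root to a later one. -/
theorem offDiag_eq_two_mul [Fintype (PosRoot I)] (hself : ∀ β, F.homDim β β = 1)
    (hinv : ∀ β γ, F.homDim (ρ.act β) (ρ.act γ) = F.homDim β γ) {mu : PosRoot I → ℕ}
    (hmu : ∀ β, mu (ρ.act β) = mu β) (hfix : ∀ β, ρ.act β = β → mu β = 0) {S : Set (PosRoot I)}
    (hS : ρ.nonfixed ⊆ S) {N : ℕ} {β : Fin N → PosRoot I}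
    (h : F.IsAdmissible S (ρ.pairedList β)) :
    offDiag F.homDim mu = 2 * ∑ j, ∑ i ∈ Finset.Iio j, mu (β i) * mu (β j) *
      (F.homDim (β i) (β j) + F.homDim (β i) (ρ.act (β j))) := by
  have hout : ∀ γ, γ ∉ ρ.pairedList β → mu γ = 0 := fun γ hγ => hfix γ <| by
    by_contra hne
    exact hγ ((h.2.1 γ).2 (hS hne))
  let K : PosRoot I → PosRoot I → ℕ := fun β γ =>
    mu β * mu γ * if β = γ then 0 else F.homDim γ β
  have hK : ∀ β γ, K (ρ.act β) (ρ.act γ) = K β γ := fun β γ => by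
    have : ρ.act β = ρ.act γ ↔ β = γ :=
      ⟨fun e => by rw [← ρ.act_act β, e, ρ.act_act], fun e => by rw [e]⟩
    simp only [K, hmu, hinv, this]
  have hK' : ∀ β γ, K (ρ.act β) γ = K β (ρ.act γ) := fun β γ => by
    rw [← hK β, ρ.act_act]
  have hrow : ∀ γ, ∑ γ', K γ γ' = ∑ j, (K γ (β j) + K γ (ρ.act (β j))) := fun γ =>
    ρ.sum_pairedList (K γ) (fun γ' e => by simp [K, hfix γ' e]) h.1
      fun γ' e => by simp [K, hout γ' e]
  have hsum : offDiag F.homDim mu = ∑ j, (∑ γ', K (β j) γ' + ∑ γ', K (ρ.act (β j)) γ') :=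
    ρ.sum_pairedList (fun γ => ∑ γ', K γ γ') (fun γ e => by simp [K, hfix γ e]) h.1
      fun γ e => by simp [K, hout γ e]
  rw [hsum, Finset.mul_sum]
  refine Finset.sum_congr rfl fun j _ => ?_
  have hswap : ∑ i, (K (ρ.act (β j)) (β i) + K (ρ.act (β j)) (ρ.act (β i))) =
      ∑ i, (K (β j) (β i) + K (β j) (ρ.act (β i))) :=
    Finset.sum_congr rfl fun i _ => by rw [hK, hK', add_comm]
  rw [hrow, hrow, hswap, ← two_mul]
  congr 1
  have hmem : ∀ i, β i ∈ ρ.orbit (β i) := fun i => ρ.mem_orbit.2 (Or.inl rfl)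
  have hmem' : ∀ i, ρ.act (β i) ∈ ρ.orbit (β i) := fun i => ρ.mem_orbit.2 (Or.inr rfl)
  rw [← Finset.sum_subset (Finset.subset_univ (Finset.Iio j))]
  · refine Finset.sum_congr rfl fun i hi => ?_
    have hij : i < j := Finset.mem_Iio.1 hi
    have h1 : β j ≠ β i := fun e => by
      have := h.homDim_eq_zero ρ hij (hmem i) (hmem j)
      rw [e, hself] at this
      exact one_ne_zero this
    have h2 : β j ≠ ρ.act (β i) := fun e => by
      have := h.homDim_eq_zero ρ hij (hmem' i) (hmem j)
      rw [e, hself] at this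
      exact one_ne_zero this
    have h3 : F.homDim (ρ.act (β i)) (β j) = F.homDim (β i) (ρ.act (β j)) := by
      rw [← hinv, ρ.act_act]
    simp only [K, if_neg h1, if_neg h2, hmu, h3]
    ring
  · intro i _ hi
    rcases (not_lt.1 fun hij => hi (Finset.mem_Iio.2 hij)).eq_or_lt with rfl | hij
    · by_cases e : ρ.act (β j) = β j
      · simp [K, hfix _ e]
      · simp [K, h.homDim_act_self ρ j e]
    · simp [K, h.homDim_eq_zero ρ hij (hmem j) (hmem i),
        h.homDim_eq_zero ρ hij (hmem j) (hmem' i)]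

theorem sqrtFormula_sq [Fintype (PosRoot I)] (hself : ∀ β, F.homDim β β = 1)
    (hinv : ∀ β γ, F.homDim (ρ.act β) (ρ.act γ) = F.homDim β γ) {mu : PosRoot I → ℕ}
    (hmu : ∀ β, mu (ρ.act β) = mu β) (hfix : ∀ β, ρ.act β = β → mu β = 0) {S : Set (PosRoot I)}
    (hS : ρ.nonfixed ⊆ S) {N : ℕ} {β : Fin N → PosRoot I}
    (h : F.IsAdmissible S (ρ.pairedList β)) :
    F.sqrtFormula ρ mu β ^ 2 = autPoly F.homDim mu := by
  have hdiag : ∏ γ, rootAutPoly (mu γ) = ∏ j, rootAutPoly (mu (β j)) ^ 2 := by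
    have hfix' : ∀ γ, ρ.act γ = γ → rootAutPoly (mu γ) = 1 := fun γ e => by
      rw [hfix γ e, rootAutPoly_zero]
    rw [ρ.prod_pairedList (fun γ => rootAutPoly (mu γ)) hfix' h.1 fun γ hγ => hfix' γ <| by
      by_contra hne
      exact hγ ((h.2.1 γ).2 (hS hne))]
    exact Finset.prod_congr rfl fun j _ => by rw [hmu, sq]
  have hexp : 2 * (offDiag F.homDim mu : ℤ) = 2 * ∑ j, ∑ i ∈ Finset.Iio j,
      2 * (mu (β i) : ℤ) * mu (β j) *
        ((F.homDim (β i) (β j) : ℤ) + F.homDim (β i) (ρ.act (β j))) := by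
    rw [offDiag_eq_two_mul ρ hself hinv hmu hfix hS h]
    push_cast
    simp only [Finset.mul_sum]
    exact Finset.sum_congr rfl fun j _ => Finset.sum_congr rfl fun i _ => by ring
  rw [autPoly, hdiag, hexp, Finset.prod_pow, two_mul, T_add, ← sq, T_sum, ← mul_pow,
    IndecFamily.sqrtFormula]
  simp only [T_sum]

theorem eval₂_sqrtFormula_pos (F : IndecFamily k I) (mu : PosRoot I → ℕ) {N : ℕ}
    (β : Fin N → PosRoot I) :
    0 < eval₂ (Int.castRingHom ℝ) unitTwo (F.sqrtFormula ρ mu β) := by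
  rw [IndecFamily.sqrtFormula, map_mul, map_prod, map_prod]
  refine mul_pos (Finset.prod_pos fun j _ => ?_)
    (Finset.prod_pos fun j _ => eval₂_rootAutPoly_pos _)
  rw [map_prod]
  exact Finset.prod_pos fun i _ => eval₂_T_pos _

theorem eq_of_sq_eq_of_eval₂_pos {a b : ℤ[T;T⁻¹]} (h : a ^ 2 = b ^ 2)
    (ha : 0 < eval₂ (Int.castRingHom ℝ) unitTwo a) (hb : 0 < eval₂ (Int.castRingHom ℝ) unitTwo b) :
    a = b := by
  rcases sq_eq_sq_iff_eq_or_eq_neg.1 h with e | e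
  · exact e
  · rw [e, map_neg] at ha
    linarith

end SquareRoot

end IQuiver

theorem lemma4p6 {I : Type} [Quiver.{0} I] [DecidableEq I] [Fintype I]
    (hQ : IQuiver.IsDynkin I) (ρ : IQuiver.Involution I)
    (lam : IQuiver.PosRoot I → ℕ) (hlam : ρ.IsF lam) :
    -- the automorphism polynomial of multiples of a positive root
    (∀ (γ : IQuiver.PosRoot I) (m : ℕ),
      IQuiver.IsAutPoly (Pi.single γ m) (IQuiver.rootAutPoly m)) ∧
    ∃ a b : ℤ[T;T⁻¹],
      -- `a` is the automorphism polynomial of `lam_c`, and it is a square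
      IQuiver.IsAutPoly (ρ.cPart lam) a ∧
      (∀ a' : ℤ[T;T⁻¹], IQuiver.IsAutPoly (ρ.cPart lam) a' → a' = a) ∧
      a = b ^ 2 ∧
      -- the square root is given by any admissible ordering, and such orderings exist
      ∀ (k : Type) [Field k] [Finite k] (F : IQuiver.IndecFamily k I)
        (S : Set (IQuiver.PosRoot I)), ρ.nonfixed ⊆ S →
          (∃ (N : ℕ) (β : Fin N → IQuiver.PosRoot I), F.IsAdmissible S (ρ.pairedList β)) ∧
          ∀ (N : ℕ) (β : Fin N → IQuiver.PosRoot I), F.IsAdmissible S (ρ.pairedList β) →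
            b = F.sqrtFormula ρ (ρ.cPart lam) β := by
  have := IQuiver.finite_posRoot hQ.isPosForm
  have := Fintype.ofFinite (IQuiver.PosRoot I)
  obtain ⟨hex, w, H, hw, hself, hzero, hH⟩ := hQ.exists_weight
  have hautPoly := IQuiver.isAutPoly_autPoly hex hw hself hzero hH
  have := Fact.mk Nat.prime_two
  obtain ⟨F₀⟩ := hex (ZMod 2)
  -- twisting a family by the involution gives another family, so its dimensions are the same
  have hinv : ∀ β γ, H (ρ.act β) (ρ.act γ) = H β γ := fun β γ => by
    rw [← hH _ F₀, ← F₀.homDim_twist, hH]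
  have hHF : ∀ (k : Type) [Field k] (F : IQuiver.IndecFamily k I), F.homDim = H :=
    fun k _ F => funext fun β => funext fun γ => hH k F β γ
  have hmu : ∀ β, ρ.cPart lam (ρ.act β) = ρ.cPart lam β := fun β => by
    have : ρ.act (ρ.act β) = ρ.act β ↔ ρ.act β = β := by
      rw [ρ.act_act, eq_comm]
    simp only [IQuiver.Involution.cPart, this, hlam.1]
  have hfix : ∀ β, ρ.act β = β → ρ.cPart lam β = 0 := fun β h => if_pos h
  have horder : ∀ (k : Type) [Field k] (F : IQuiver.IndecFamily k I)
      (S : Set (IQuiver.PosRoot I)), ρ.nonfixed ⊆ S →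
      ∃ (N : ℕ) (β : Fin N → IQuiver.PosRoot I), F.IsAdmissible S (ρ.pairedList β) := by
    intro k _ F S hS
    refine IQuiver.exists_admissible ρ hw ?_ ?_ hS <;> rw [hHF]
    exacts [hzero, hinv]
  have hsq : ∀ (k : Type) [Field k] (F : IQuiver.IndecFamily k I)
      (S : Set (IQuiver.PosRoot I)), ρ.nonfixed ⊆ S →
      ∀ (N : ℕ) (β : Fin N → IQuiver.PosRoot I), F.IsAdmissible S (ρ.pairedList β) →
        F.sqrtFormula ρ (ρ.cPart lam) β ^ 2 = IQuiver.autPoly H (ρ.cPart lam) := by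
    intro k _ F S hS N β h
    rw [← hHF k F]
    refine IQuiver.sqrtFormula_sq ρ ?_ ?_ hmu hfix hS h <;> rw [hHF]
    exacts [hself, hinv]
  obtain ⟨N₀, β₀, h₀⟩ := horder _ F₀ Set.univ (Set.subset_univ _)
  have hsq₀ := hsq _ F₀ _ (Set.subset_univ _) _ _ h₀
  refine ⟨fun γ m => ?_, IQuiver.autPoly H (ρ.cPart lam), F₀.sqrtFormula ρ (ρ.cPart lam) β₀,
    hautPoly _, fun a' ha' => IQuiver.isAutPoly_unique ha' (hautPoly _), hsq₀.symm, ?_⟩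
  · rw [← IQuiver.autPoly_single H γ m]
    exact hautPoly _
  · intro k _ _ F S hS
    refine ⟨horder k F S hS, fun N β h => ?_⟩
    exact IQuiver.eq_of_sq_eq_of_eval₂_pos (hsq₀.trans (hsq k F S hS N β h).symm)
      (IQuiver.eval₂_sqrtFormula_pos ρ F₀ _ β₀) (IQuiver.eval₂_sqrtFormula_pos ρ F _ β)
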